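/- Let $n\ge 0$ and let $\langle x,y\rangle=x_1y_1+\dots+x_{n+1}y_{n+1}-x_{n+2}y_{n+2}$ on $\mathbb R^{n+1,1}=\mathbb R^{n+2}$. Let $\mathbb H^{n+1}=\{\langle x,x\rangle=-1,\ x_{n+2}>0\}$ be hyperbolic space, and $$T^1\mathbb H^{n+1}=\{(x,v): x\in\mathbb H^{n+1},\ \langle x,v\rangle=0,\ \langle v,v\rangle=1\}$$ its unit tangent bundle, with the geodesic flow $\varphi_t(x,v)=(\cosh t\,x+\sinh t\,v,\ \sinh t\,x+\cosh t\,v)$ and its infinitesimal generator $\chi_{(x,v)}=(v,x)$. Let $\mathcal G_{n+1}\cong(\partial\mathbb H^{n+1}\times\partial\mathbb H^{n+1})\setminus\Delta$ be the manifold of oriented unparametrized geodesics of $\mathbb H^{n+1}$, and let $\mathrm p:T^1\mathbb H^{n+1}\to\mathcal G_{n+1}$ send $(x,v)$ to the oriented geodesic through $x$ with velocity $v$. This is the principal $\mathbb R$-bundle given by the geodesic flow. The para-Sasaki metric $g$ on $T^1\mathbb H^{n+1}$ is the one for which horizontal and vertical vectors are orthogonal, $g(u_1^{\mathcal H},u_2^{\mathcal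 H})=\langle u_1,u_2\rangle$ for horizontal lifts and $g(w_1^{\mathcal V},w_2^{\mathcal V})=-\langle w_1,w_2\rangle$ for vertical lifts. Let $\omega=g(\cdot,\chi)$ and let $J(\dot x,\dot v)=(\dot v,\dot x)$ on $\chi^\perp=\ker\omega$. The differential of $\mathrm p$ identifies $\chi^\perp_{(x,v)}$ with $T_{\mathrm p(x,v)}\mathcal G_{n+1}$. Let $\mathbb G$ and $\mathbb J$ be the push-forwards of $g|_{\chi^\perp}$ and $J$, and let $\Omega=\mathbb G(\cdot,\mathbb J\,\cdot)$ be the fundamental $2$-form. The exterior derivative of a $1$-form is normalised by $d\eta(X,Y)=X(\eta(Y))-Y(\eta(X))-\eta([X,Y])$, with $[X,Y]f=X(Yf)-Y(Xf)$. Then: 1. The fibres of $\mathrm p$ are the orbits of the geodesic flow, and $\omega$ is a connection form: it is smooth, $\varphi_t^*\omega=\omega$ for all $t$, and $\omega(\chi)=1$. 2. $\mathbb G$ and $\mathbb J$ are well defined, that is, they do not depend on the choice of $(x,v)$ in a fibre of $\mathrm p$. 3. The curvature of $\omega$ is $$d\omega=-\,\mathrm p^*\Omega ,$$ equivalently $d\omega=\mathrm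 p^*\big(\mathbb G(\mathbb J\,\cdot,\cdot)\big)$. 4. $\Omega$ is a symplectic form: it is smooth, non-degenerate and closed, $d\Omega=0$. -/

import Mathlib

open Metric
open scoped Manifold ContDiff
noncomputable section
namespace GeodesicSpace

section Forms
variable {E : Type*} [NormedAddCommGroup E] [NormedSpace ℝ E] {H : Type*} [TopologicalSpace H]
  (I : ModelWithCorners ℝ E H) {M : Type*} [TopologicalSpace M] [ChartedSpace H M]
  {E' : Type*} [NormedAddCommGroup E'] [NormedSpace ℝ E'] {H' : Type*} [TopologicalSpace H']
  (I' : ModelWithCorners ℝ E' H') {M' : Type*} [TopologicalSpace M'] [ChartedSpace H' M']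

/-- Differential `k`-forms on a manifold, as families of alternating forms on the tangent spaces
(without any regularity). -/
abbrev DForm (M : Type*) [TopologicalSpace M] [ChartedSpace H M] (k : ℕ) : Type _ :=
  (x : M) → TangentSpace I x [⋀^Fin k]→L[ℝ] ℝ

/-- The expression of a form in the chart at `x₀`, i.e. its pullback by the inverse of that chart. -/
def formInChart {k : ℕ} (η : DForm I M k) (x₀ : M) (y : E) : E [⋀^Fin k]→L[ℝ] ℝ :=
  (η ((extChartAt I x₀).symm y)).compContinuousLinearMap
    (mfderivWithin 𝓘(ℝ, E) I (extChartAt I x₀).symm (Set.range I) y)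

/-- Smoothness of a form: its expression in every chart is smooth. -/
def SmoothForm {k : ℕ} (η : DForm I M k) : Prop :=
  ∀ x₀ : M, ContDiffOn ℝ ∞ (formInChart I η x₀) (extChartAt I x₀).target

/-- The exterior derivative on a manifold: the exterior derivative of the expression in the chart
at `x`, pulled back by this chart. In degree one,
`dη(X, Y) = X(η(Y)) - Y(η(X)) - η([X, Y])`. -/
def extD {k : ℕ} (η : DForm I M k) : DForm I M (k + 1) := fun x =>
  (extDerivWithin (formInChart I η x) (Set.range I)
    (extChartAt I x x)).compContinuousLinearMap (mfderiv I 𝓘(ℝ, E) (extChartAt I x) x)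

/-- The pullback `f^* η` of a form by a map. -/
def formPullback {k : ℕ} (f : M → M') (η : DForm I' M' k) : DForm I M k := fun x =>
  (η (f x)).compContinuousLinearMap (mfderiv I I' f x)

end Forms

/-- The charts on `M` obtained by composing a homeomorphism `h : M ≃ₜ N` with the charts of `N`. -/
@[reducible] def transportCharts {H M N : Type*} [TopologicalSpace H] [TopologicalSpace M] [TopologicalSpace N]
    [ChartedSpace H N] (h : M ≃ₜ N) : ChartedSpace H M where
  atlas := {e | ∃ e' ∈ atlas H N, e = h.toOpenPartialHomeomorph.trans e'}
  chartAt x := h.toOpenPartialHomeomorph.trans (chartAt H (h x))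
  mem_chart_source x := by simp
  chart_mem_atlas x := ⟨_, chart_mem_atlas H (h x), rfl⟩

section Transport
variable {E : Type*} [NormedAddCommGroup E] [NormedSpace ℝ E] {H : Type*} [TopologicalSpace H]
  (I : ModelWithCorners ℝ E H) {M N : Type*} [TopologicalSpace M] [TopologicalSpace N]
  [ChartedSpace H N] (h : M ≃ₜ N) (k : ℕ∞ω)

theorem transport_isManifold [IsManifold I k N] :
    @IsManifold ℝ _ E _ _ H _ I k M _ (transportCharts h) := by
  let _ := transportCharts (H := H) h
  refine { compatible := ?_ }
  rintro _ _ ⟨e, he, rfl⟩ ⟨e', he', rfl⟩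
  have key := HasGroupoid.compatible (G := contDiffGroupoid k I) he he'
  refine (contDiffGroupoid k I).mem_of_eqOnSource key ?_
  rw [OpenPartialHomeomorph.trans_symm_eq_symm_trans_symm]
  refine ⟨?_, ?_⟩
  · ext y; simp
  · intro y hy; simp

theorem transport_contMDiff [IsManifold I k N] :
    @ContMDiff ℝ _ E _ _ H _ I M _ (transportCharts h) E _ _ H _ I N _ _ k h := by
  let _ := transportCharts (H := H) h
  intro x
  rw [contMDiffAt_iff]
  refine ⟨h.continuous.continuousAt, ?_⟩
  refine contDiffWithinAt_id.congr_of_eventuallyEq (f := id) ?_ ?_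
  · have : (extChartAt I (h x)).target ∈ nhdsWithin (extChartAt I x x) (Set.range I) := 
      extChartAt_target_mem_nhdsWithin (I := I) (h x)
    filter_upwards [this] with y hy
    have : (extChartAt I x).symm y = h.symm ((extChartAt I (h x)).symm y) := rfl
    simp only [Function.comp, this, h.apply_symm_apply]
    exact (extChartAt I (h x)).right_inv hy
  · have : (extChartAt I x).symm (extChartAt I x x) = x := extChartAt_to_inv (I := I) x
    simp only [Function.comp, this]; rfl

theorem transport_contMDiff_symm [IsManifold I k N] :
    @ContMDiff ℝ _ E _ _ H _ I N _ _ E _ _ H _ I M _ (transportCharts h) k h.symm := by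
  let _ := transportCharts (H := H) h
  intro x
  obtain ⟨x, rfl⟩ := h.surjective x
  rw [contMDiffAt_iff]
  refine ⟨h.symm.continuous.continuousAt, ?_⟩
  rw [h.symm_apply_apply]
  refine contDiffWithinAt_id.congr_of_eventuallyEq (f := id) ?_ ?_
  · have : (extChartAt I (h x)).target ∈ nhdsWithin (extChartAt I (h x) (h x)) (Set.range I) := 
      extChartAt_target_mem_nhdsWithin (I := I) (h x)
    filter_upwards [this] with y hy
    have : ∀ z, (extChartAt I x) z = (extChartAt I (h x)) (h z) := fun z => rfl
    simp only [Function.comp, this, h.apply_symm_apply]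
    exact (extChartAt I (h x)).right_inv hy
  · have : ∀ z, (extChartAt I x) z = (extChartAt I (h x)) (h z) := fun z => rfl
    have h2 : (extChartAt I (h x)).symm (extChartAt I (h x) (h x)) = h x :=
      extChartAt_to_inv (I := I) (h x)
    simp only [Function.comp, this, h2, h.apply_symm_apply]; rfl
end Transport

theorem continuous_bilin {V : Type*} [AddCommGroup V] [Module ℝ V] [TopologicalSpace V]
    [IsTopologicalAddGroup V] [ContinuousSMul ℝ V] [T2Space V] [FiniteDimensional ℝ V]
    (B : V →ₗ[ℝ] V →ₗ[ℝ] ℝ) : Continuous fun q : V × V => B q.1 q.2 := by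
  have h : ∀ q : V × V, B q.1 q.2 = ∑ i, ∑ j, (Module.finBasis ℝ V).repr q.1 i *
      ((Module.finBasis ℝ V).repr q.2 j *
        B (Module.finBasis ℝ V i) (Module.finBasis ℝ V j)) := by
    intro q
    conv_lhs => rw [← (Module.finBasis ℝ V).sum_repr q.1, ← (Module.finBasis ℝ V).sum_repr q.2]
    simp only [map_sum, map_smul, LinearMap.sum_apply, LinearMap.smul_apply, smul_eq_mul,
      Finset.mul_sum]
    rw [Finset.sum_comm]
    exact Finset.sum_congr rfl fun i _ => Finset.sum_congr rfl fun j _ => by ring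
  have hc : ∀ i, Continuous fun x : V => (Module.finBasis ℝ V).repr x i := fun i =>
    ((Module.finBasis ℝ V).coord i).continuous_of_finiteDimensional
  simp_rw [h]
  exact continuous_finsetSum _ fun i _ => continuous_finsetSum _ fun j _ =>
    ((hc i).comp continuous_fst).mul (((hc j).comp continuous_snd).mul continuous_const)

/-- An alternating bilinear form on a finite dimensional space, as an alternating map of two
vectors `a 0`, `a 1`. -/
def twoForm {V : Type*} [AddCommGroup V] [Module ℝ V] [TopologicalSpace V]
    [IsTopologicalAddGroup V] [ContinuousSMul ℝ V] [T2Space V] [FiniteDimensional ℝ V]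
    (B : V →ₗ[ℝ] V →ₗ[ℝ] ℝ) (hB : ∀ x, B x x = 0) : V [⋀^Fin 2]→L[ℝ] ℝ where
  toFun a := B (a 0) (a 1)
  map_update_add' a i x y := by
    rename_i inst
    rw [Subsingleton.elim inst (instDecidableEqFin 2)]
    fin_cases i <;> simp
  map_update_smul' a i c x := by
    rename_i inst
    rw [Subsingleton.elim inst (instDecidableEqFin 2)]
    fin_cases i <;> simp
  map_eq_zero_of_eq' a i j hij hne := by
    fin_cases i <;> fin_cases j <;> simp_all
  cont := (continuous_bilin B).comp (by fun_prop : Continuous fun a : Fin 2 → V => (a 0, a 1))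

/-- Euclidean space `ℝ^{n+1}`. -/
abbrev Euc (n : ℕ) : Type := EuclideanSpace ℝ (Fin (n + 1))

/-- Minkowski space `ℝ^{n+1,1}`; the second component is the last (time) coordinate. -/
abbrev Mink (n : ℕ) : Type := Euc n × ℝ

/-- The Euclidean scalar product as a continuous bilinear map. -/
def euc (n : ℕ) : Euc n →L[ℝ] Euc n →L[ℝ] ℝ := innerSL ℝ

/-- The bilinear form of signature `(n+1, 1)`, `⟨x, y⟩ = x₁ y₁ + ⋯ + xₙ₊₁ yₙ₊₁ - xₙ₊₂ yₙ₊₂`. -/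
def mink (n : ℕ) : Mink n →L[ℝ] Mink n →L[ℝ] ℝ :=
  (euc n).bilinearComp (ContinuousLinearMap.fst ℝ (Euc n) ℝ) (ContinuousLinearMap.fst ℝ (Euc n) ℝ) -
    (ContinuousLinearMap.mul ℝ ℝ).bilinearComp (ContinuousLinearMap.snd ℝ (Euc n) ℝ)
      (ContinuousLinearMap.snd ℝ (Euc n) ℝ)

theorem mink_apply {n : ℕ} (x y : Mink n) : mink n x y = inner ℝ x.1 y.1 - x.2 * y.2 := by
  simp [mink, euc]; rfl

theorem mink_comm {n : ℕ} (x y : Mink n) : mink n x y = mink n y x := by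
  rw [mink_apply, mink_apply, real_inner_comm, mul_comm]

/-- The unit tangent bundle of hyperbolic space `H^{n+1}` in the hyperboloid model: the pairs
`(x, v)` with `⟨x, x⟩ = -1`, `x_{n+2} > 0`, `⟨x, v⟩ = 0`, `⟨v, v⟩ = 1`. -/
def UT (n : ℕ) : Type :=
  {z : Mink n × Mink n //
    (mink n z.1 z.1 = -1 ∧ 0 < z.1.2) ∧ mink n z.1 z.2 = 0 ∧ mink n z.2 z.2 = 1}

namespace UT
variable {n : ℕ}

instance : TopologicalSpace (UT n) := instTopologicalSpaceSubtype

/-- The inclusion in `ℝ^{n+1,1} × ℝ^{n+1,1}`. -/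
def incl (z : UT n) : Mink n × Mink n := z.1

/-- The base point `x` of `(x, v)`. -/
def pt (z : UT n) : Mink n := z.1.1

/-- The unit tangent vector `v` of `(x, v)`. -/
def vec (z : UT n) : Mink n := z.1.2

theorem mink_pt_pt (z : UT n) : mink n z.pt z.pt = -1 := z.2.1.1
theorem pt_pos (z : UT n) : 0 < z.pt.2 := z.2.1.2
theorem mink_pt_vec (z : UT n) : mink n z.pt z.vec = 0 := z.2.2.1
theorem mink_vec_pt (z : UT n) : mink n z.vec z.pt = 0 := by rw [mink_comm, mink_pt_vec]
theorem mink_vec_vec (z : UT n) : mink n z.vec z.vec = 1 := z.2.2.2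

theorem inner_pt_pt (z : UT n) : inner ℝ z.pt.1 z.pt.1 = z.pt.2 * z.pt.2 - 1 := by
  have := z.mink_pt_pt; rw [mink_apply] at this; linarith
theorem inner_pt_vec (z : UT n) : inner ℝ z.pt.1 z.vec.1 = z.pt.2 * z.vec.2 := by
  have := z.mink_pt_vec; rw [mink_apply] at this; linarith
theorem inner_vec_vec (z : UT n) : inner ℝ z.vec.1 z.vec.1 = 1 + z.vec.2 * z.vec.2 := by
  have := z.mink_vec_vec; rw [mink_apply] at this; linarith

theorem abs_vec_lt (z : UT n) : |z.vec.2| < z.pt.2 := by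
  have h := real_inner_mul_inner_self_le z.pt.1 z.vec.1
  rw [inner_pt_pt, inner_pt_vec, inner_vec_vec] at h
  refine abs_lt_of_sq_lt_sq ?_ z.pt_pos.le
  nlinarith

theorem sub_pos (z : UT n) : 0 < z.pt.2 - z.vec.2 := by
  have := (abs_lt.1 z.abs_vec_lt).2; linarith
theorem add_pos (z : UT n) : 0 < z.pt.2 + z.vec.2 := by
  have := (abs_lt.1 z.abs_vec_lt).1; linarith

/-- The vector of `ℝ^{n+1}` that is sent to `v` by the hyperbolic boost which sends the origin
`(0, 1)` of hyperbolic space to `x`. -/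
def frame (z : UT n) : Euc n := z.vec.1 - (z.vec.2 / (1 + z.pt.2)) • z.pt.1

theorem frame_mem (z : UT n) : z.frame ∈ sphere (0 : Euc n) 1 := by
  have h : inner ℝ z.frame z.frame = (1 : ℝ) := by
    have hp := z.pt_pos
    simp only [frame, inner_sub_left, inner_sub_right, inner_smul_left, inner_smul_right,
      real_inner_comm z.pt.1 z.vec.1, inner_pt_pt, inner_pt_vec, inner_vec_vec]
    simp only [conj_trivial]
    field_simp
    ring
  rw [real_inner_self_eq_norm_sq] at h
  rw [mem_sphere_zero_iff_norm]
  nlinarith [norm_nonneg z.frame]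

/-- The last coordinate of the point of the hyperboloid over `y`. -/
def height (y : Euc n) : ℝ := √(1 + ‖y‖ ^ 2)

theorem height_pos (y : Euc n) : 0 < height y := by unfold height; positivity

theorem height_sq (y : Euc n) : height y * height y = 1 + inner ℝ y y := by
  rw [real_inner_self_eq_norm_sq]; exact Real.mul_self_sqrt (by positivity)

/-- Over the point of the hyperboloid with space coordinates `q.1`, the image of `q.2` by the
boost. -/
def unframe (q : Euc n × Euc n) : Mink n × Mink n :=
  ((q.1, height q.1),
    (q.2 + (inner ℝ q.1 q.2 / (1 + height q.1)) • q.1, inner ℝ q.1 q.2))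

theorem unframe_mem (y : Euc n) (u : sphere (0 : Euc n) 1) :
    (mink n (unframe (y, ↑u)).1 (unframe (y, ↑u)).1 = -1 ∧ 0 < (unframe (y, (u : Euc n))).1.2) ∧
    mink n (unframe (y, ↑u)).1 (unframe (y, ↑u)).2 = 0 ∧
    mink n (unframe (y, ↑u)).2 (unframe (y, ↑u)).2 = 1 := by
  have hp := height_pos y
  have hs := height_sq y
  have hs' : inner ℝ y y = height y * height y - 1 := by linarith
  have hu : inner ℝ (u : Euc n) (u : Euc n) = (1 : ℝ) := by
    rw [real_inner_self_eq_norm_sq, norm_eq_of_mem_sphere]; norm_num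
  simp only [unframe, mink_apply, inner_add_left, inner_add_right, inner_smul_left,
    inner_smul_right, conj_trivial, hs', hu, real_inner_comm y (u : Euc n)]
  refine ⟨⟨by ring, hp⟩, ?_, ?_⟩ <;> · field_simp; ring

/-- The unit tangent bundle is homeomorphic to `ℝ^{n+1} × S^n`. This is used for the charts. -/
def trivialization (n : ℕ) : UT n ≃ₜ Euc n × sphere (0 : Euc n) 1 where
  toFun z := (z.pt.1, ⟨z.frame, z.frame_mem⟩)
  invFun q := ⟨unframe (q.1, q.2), unframe_mem q.1 q.2⟩
  left_inv z := by
    have hp := z.pt_pos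
    have hh : height z.pt.1 = z.pt.2 := by
      have h1 := height_sq z.pt.1
      rw [inner_pt_pt] at h1
      nlinarith [height_pos z.pt.1]
    have hi : inner ℝ z.pt.1 z.frame = z.vec.2 := by
      simp only [frame, inner_sub_right, inner_smul_right, inner_pt_pt, inner_pt_vec]
      field_simp
      ring
    refine Subtype.ext (Prod.ext (Prod.ext rfl hh) (Prod.ext ?_ hi))
    simp only [unframe, hi, hh]
    simp only [frame]
    exact sub_add_cancel _ _
  right_inv q := by
    refine Prod.ext rfl (Subtype.ext ?_)
    simp only [frame, pt, vec, unframe]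
    exact add_sub_cancel_right _ _
  continuous_toFun := by
    have h1 : Continuous (pt : UT n → Mink n) := continuous_fst.comp continuous_subtype_val
    have h2 : Continuous (vec : UT n → Mink n) := continuous_snd.comp continuous_subtype_val
    refine (continuous_fst.comp h1).prodMk (Continuous.subtype_mk ?_ _)
    unfold frame
    refine (continuous_fst.comp h2).sub (((continuous_snd.comp h2).div
      (continuous_const.add (continuous_snd.comp h1)) fun z => ?_).smul (continuous_fst.comp h1))
    have := z.pt_pos
    exact (by positivity : (1 : ℝ) + z.pt.2 ≠ 0)
  continuous_invFun := by
    refine Continuous.subtype_mk ?_ _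
    unfold unframe height
    have : ∀ q : Euc n × sphere (0 : Euc n) 1, 1 + √(1 + ‖q.1‖ ^ 2) ≠ 0 := fun q => by positivity
    fun_prop (disch := assumption)

/-- The model with corners of the `(2n+1)`-manifold `T^1 H^{n+1}`. -/
abbrev model (n : ℕ) := 𝓘(ℝ, Euc n).prod (𝓡 n)

/-- The smooth structure of the unit tangent bundle. It is the one of a submanifold of
`ℝ^{n+1,1} × ℝ^{n+1,1}`: the topology is the induced one by definition, the inclusion is smooth by
`contMDiff_incl` and it is an immersion by `dIncl_injective`. -/
instance : ChartedSpace (ModelProd (Euc n) (EuclideanSpace ℝ (Fin n))) (UT n) :=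
  transportCharts (trivialization n)

instance : IsManifold (model n) ∞ (UT n) :=
  transport_isManifold (model n) (trivialization n) ∞

theorem contMDiff_trivialization :
    ContMDiff (model n) (model n) ∞ (trivialization n) :=
  transport_contMDiff (model n) (trivialization n) ∞

theorem contMDiff_trivialization_symm :
    ContMDiff (model n) (model n) ∞ (trivialization n).symm :=
  transport_contMDiff_symm (model n) (trivialization n) ∞

theorem contDiff_unframe : ContDiff ℝ ∞ (unframe (n := n)) := by
  have h : ContDiff ℝ ∞ (height (n := n)) :=
    (contDiff_const.add (contDiff_norm_sq ℝ)).sqrt fun y => by positivity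
  have h1 : ContDiff ℝ ∞ fun q : Euc n × Euc n => height q.1 := h.comp contDiff_fst
  have h2 : ContDiff ℝ ∞ fun q : Euc n × Euc n => (inner ℝ q.1 q.2 : ℝ) :=
    contDiff_fst.inner ℝ contDiff_snd
  unfold unframe
  refine (contDiff_fst.prodMk h1).prodMk (ContDiff.prodMk (contDiff_snd.add
    ((h2.div (contDiff_const.add h1) fun q => ?_).smul contDiff_fst)) h2)
  have := height_pos q.1
  positivity

theorem contMDiff_incl : ContMDiff (model n) 𝓘(ℝ, Mink n × Mink n) ∞ (incl (n := n)) := by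
  have h : (incl (n := n)) =
      unframe ∘ (fun q : Euc n × sphere (0 : Euc n) 1 => (q.1, (q.2 : Euc n))) ∘
        trivialization n := by
    ext1 z
    exact congrArg Subtype.val ((trivialization n).left_inv z).symm
  rw [h]
  refine contDiff_unframe.contMDiff.comp (ContMDiff.comp ?_ contMDiff_trivialization)
  have : Fact (Module.finrank ℝ (Euc n) = n + 1) := ⟨finrank_euclideanSpace_fin⟩
  exact contMDiff_fst.prodMk_space
    ((contMDiff_coe_sphere (E := Euc n) (n := n)).comp contMDiff_snd)

/-- The tangent space of `T^1 H^{n+1}` at `z`. -/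
abbrev T (z : UT n) : Type := TangentSpace (model n) z

instance (z : UT n) : FiniteDimensional ℝ z.T :=
  inferInstanceAs (FiniteDimensional ℝ (Euc n × EuclideanSpace ℝ (Fin n)))
instance (z : UT n) : T2Space z.T :=
  inferInstanceAs (T2Space (Euc n × EuclideanSpace ℝ (Fin n)))

theorem finrank_T (z : UT n) : Module.finrank ℝ z.T = 2 * n + 1 := by
  have : Module.finrank ℝ (Euc n × EuclideanSpace ℝ (Fin n)) = 2 * n + 1 := by
    simp; ring
  exact this

/-- The differential of the inclusion, which sends a tangent vector to the pair `(ẋ, v̇)`. -/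
def dIncl (z : UT n) : z.T →L[ℝ] Mink n × Mink n := mvfderiv (model n) incl z

/-- The tangent space in the hyperboloid model: the pairs `(ẋ, v̇)` with `⟨x, ẋ⟩ = 0`,
`⟨v, v̇⟩ = 0` and `⟨x, v̇⟩ + ⟨v, ẋ⟩ = 0`. -/
def tangentModel (z : UT n) : Submodule ℝ (Mink n × Mink n) where
  carrier := {X | mink n z.pt X.1 = 0 ∧ mink n z.vec X.2 = 0 ∧
    mink n z.pt X.2 + mink n z.vec X.1 = 0}
  add_mem' {X Y} hX hY := by
    obtain ⟨h1, h2, h3⟩ := hX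
    obtain ⟨k1, k2, k3⟩ := hY
    refine ⟨?_, ?_, ?_⟩ <;> simp only [Prod.fst_add, Prod.snd_add, map_add] <;> linarith
  zero_mem' := by simp
  smul_mem' c X hX := by
    obtain ⟨h1, h2, h3⟩ := hX
    refine ⟨by simp [h1], by simp [h2], ?_⟩
    simp only [Prod.smul_fst, Prod.smul_snd, map_smul, smul_eq_mul, ← mul_add, h3, mul_zero]

theorem finrank_tangentModel (z : UT n) : Module.finrank ℝ z.tangentModel = 2 * n + 1 := by
  let L : Mink n × Mink n →ₗ[ℝ] ℝ × ℝ × ℝ :=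
    ((mink n z.pt).toLinearMap ∘ₗ LinearMap.fst ℝ _ _).prod
      (((mink n z.vec).toLinearMap ∘ₗ LinearMap.snd ℝ _ _).prod
        ((mink n z.pt).toLinearMap ∘ₗ LinearMap.snd ℝ _ _ +
          (mink n z.vec).toLinearMap ∘ₗ LinearMap.fst ℝ _ _))
  have hL : ∀ X, L X = (mink n z.pt X.1, mink n z.vec X.2,
    mink n z.pt X.2 + mink n z.vec X.1) := fun X => rfl
  have hker : z.tangentModel = LinearMap.ker L := by
    ext X
    simp only [LinearMap.mem_ker, hL, Prod.mk_eq_zero]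
    rfl
  have hsurj : LinearMap.range L = ⊤ := by
    rw [LinearMap.range_eq_top]
    rintro ⟨a, b, c⟩
    refine ⟨(-a • z.pt, b • z.vec - c • z.pt), ?_⟩
    simp [hL, mink_pt_pt, mink_pt_vec, mink_vec_pt, mink_vec_vec]
  have h := LinearMap.finrank_range_add_finrank_ker L
  rw [hsurj, ← hker, finrank_top] at h
  simp at h
  omega

theorem mdifferentiable_incl : MDifferentiable (model n) 𝓘(ℝ, Mink n × Mink n) (incl (n := n)) :=
  contMDiff_incl.mdifferentiable (by simp)

theorem mvfderiv_comp_incl {F : Type*} [NormedAddCommGroup F] [NormedSpace ℝ F]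
    {q : Mink n × Mink n → F} {q' : Mink n × Mink n →L[ℝ] F} (z : UT n)
    (hq : HasFDerivAt q q' z.incl) (X : z.T) :
    mvfderiv (model n) (q ∘ incl) z X = q' (z.dIncl X) := by
  have h := HasMFDerivAt.comp z hq.hasMFDerivAt (mdifferentiable_incl z).hasMFDerivAt
  exact congrArg (fun f => f X) h.mfderiv

theorem dIncl_mem (z : UT n) (X : z.T) : z.dIncl X ∈ z.tangentModel := by
  have hc : ∀ (q : Mink n × Mink n → ℝ) (q' : Mink n × Mink n →L[ℝ] ℝ) (c : ℝ),
      HasFDerivAt q q' z.incl → (∀ w : UT n, q w.incl = c) → q' (z.dIncl X) = 0 := by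
    intro q q' c hq hcst
    rw [← mvfderiv_comp_incl z hq X]
    have : q ∘ incl = fun _ : UT n => c := funext hcst
    rw [this, mvfderiv_const]
    rfl
  have hb : ∀ f g : Mink n × Mink n →L[ℝ] Mink n, HasFDerivAt
      (fun w => mink n (f w) (g w))
      ((mink n (f z.incl)).comp g + ((mink n).flip (g z.incl)).comp f) z.incl := by
    intro f g
    exact ((mink n).isBoundedBilinearMap.hasFDerivAt (f z.incl, g z.incl)).comp z.incl
      (f.hasFDerivAt.prodMk g.hasFDerivAt)
  have h1 := hc _ _ (-1) (hb (.fst ℝ _ _) (.fst ℝ _ _)) mink_pt_pt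
  have h2 := hc _ _ 1 (hb (.snd ℝ _ _) (.snd ℝ _ _)) mink_vec_vec
  have h3 := hc _ _ 0 (hb (.fst ℝ _ _) (.snd ℝ _ _)) mink_pt_vec
  simp only [add_apply, ContinuousLinearMap.comp_apply,
    ContinuousLinearMap.flip_apply, ContinuousLinearMap.coe_fst', ContinuousLinearMap.coe_snd']
    at h1 h2 h3
  rw [mink_comm (z.dIncl X).1] at h1 h3
  rw [mink_comm (z.dIncl X).2] at h2
  refine ⟨?_, ?_, h3⟩
  · have : mink n z.incl.1 (z.dIncl X).1 = 0 := by linarith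
    exact this
  · have : mink n z.incl.2 (z.dIncl X).2 = 0 := by linarith
    exact this

theorem dIncl_injective (z : UT n) : Function.Injective z.dIncl := by
  rw [injective_iff_map_eq_zero]
  intro X hX
  have hF : Fact (Module.finrank ℝ (Euc n) = n + 1) := ⟨finrank_euclideanSpace_fin⟩
  have hzero : ∀ {F : Type} [NormedAddCommGroup F] [NormedSpace ℝ F] (q : Mink n × Mink n → F),
      DifferentiableAt ℝ q z.incl → mvfderiv (model n) (q ∘ incl) z X = 0 := by
    intro F _ _ q hq
    rw [mvfderiv_comp_incl z hq.hasFDerivAt X, hX, map_zero]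
  have hd : MDifferentiable (model n) (model n) (trivialization n) :=
    contMDiff_trivialization.mdifferentiable (by simp)
  have hds : MDifferentiable (model n) (model n) (trivialization n).symm :=
    contMDiff_trivialization_symm.mdifferentiable (by simp)
  set Y := mfderiv (model n) (model n) (trivialization n) z X with hY
  have hY1 : Y.1 = 0 := by
    have h := hzero (fun w => w.1.1) (by fun_prop)
    have hc := HasMFDerivAt.comp z (hasMFDerivAt_fst (I := 𝓘(ℝ, Euc n)) (I' := 𝓡 n)
      (trivialization n z)) (hd z).hasMFDerivAt
    have := congrArg (fun f => f X) hc.mfderiv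
    exact this.symm.trans h
  have hY2 : Y.2 = 0 := by
    have h := hzero (fun w => w.2.1 - (w.2.2 / (1 + w.1.2)) • w.1.1) (by
      have : (1 : ℝ) + z.incl.1.2 ≠ 0 := by
        have := z.pt_pos
        exact (by positivity : (1 : ℝ) + z.pt.2 ≠ 0)
      fun_prop (disch := assumption))
    have hs := ((contMDiff_coe_sphere (E := Euc n) (n := n) (m := ∞)).mdifferentiable (by simp)
      (trivialization n z).2).hasMFDerivAt
    have hc := HasMFDerivAt.comp z (HasMFDerivAt.comp (trivialization n z) hs
      (hasMFDerivAt_snd (I := 𝓘(ℝ, Euc n)) (I' := 𝓡 n) (trivialization n z)))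
      (hd z).hasMFDerivAt
    have h2 := congrArg (fun f => f X) hc.mfderiv
    have h3 := h2.symm.trans h
    refine injective_mvfderiv_subtypeVal_sphere (E := Euc n) (n := n) (trivialization n z).2 ?_
    exact h3.trans (map_zero _).symm
  have hY0 : Y = 0 := Prod.ext hY1 hY2
  have hc := HasMFDerivAt.comp z (hds (trivialization n z)).hasMFDerivAt (hd z).hasMFDerivAt
  have hid : (trivialization n).symm ∘ trivialization n = id :=
    funext (trivialization n).symm_apply_apply
  rw [hid] at hc
  have h4 := congrArg (fun f => f X) (hc.mfderiv.symm.trans mfderiv_id)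
  have h5 : mfderiv (model n) (model n) (trivialization n).symm (trivialization n z) Y = X := h4
  refine h5.symm.trans ?_
  rw [hY0]
  exact map_zero _

/-- The differential of the inclusion identifies the tangent space with its model. -/
def tangentEquiv (z : UT n) : z.T ≃L[ℝ] z.tangentModel :=
  (LinearEquiv.ofBijective (z.dIncl.toLinearMap.codRestrict z.tangentModel z.dIncl_mem)
    ⟨fun _ _ h => z.dIncl_injective (congrArg Subtype.val h),
      (LinearMap.injective_iff_surjective_of_finrank_eq_finrank
        (z.finrank_T.trans z.finrank_tangentModel.symm)).1
          fun _ _ h => z.dIncl_injective (congrArg Subtype.val h)⟩).toContinuousLinearEquiv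

theorem coe_tangentEquiv (z : UT n) (X : z.T) :
    (z.tangentEquiv X : Mink n × Mink n) = z.dIncl X := rfl

theorem dIncl_tangentEquiv_symm (z : UT n) (X : z.tangentModel) :
    z.dIncl (z.tangentEquiv.symm X) = X := by
  rw [← coe_tangentEquiv, ContinuousLinearEquiv.apply_symm_apply]

/-- The geodesic flow `φ_t(x, v) = (cosh t x + sinh t v, sinh t x + cosh t v)`. -/
def flow (t : ℝ) (z : UT n) : UT n :=
  ⟨(Real.cosh t • z.pt + Real.sinh t • z.vec, Real.sinh t • z.pt + Real.cosh t • z.vec), by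
    have h := Real.cosh_sq t
    have hv := z.abs_vec_lt
    have hs : |Real.sinh t| < Real.cosh t := by
      refine abs_lt_of_sq_lt_sq ?_ (Real.cosh_pos t).le
      linarith
    simp only [map_add, map_smul, add_apply, smul_apply,
      mink_pt_pt, mink_pt_vec, mink_vec_pt, mink_vec_vec, smul_eq_mul]
    refine ⟨⟨by nlinarith, ?_⟩, by ring, by nlinarith⟩
    have h1 : |Real.sinh t * z.vec.2| < Real.cosh t * z.pt.2 := by
      rw [abs_mul]
      exact mul_lt_mul'' hs hv (abs_nonneg _) (abs_nonneg _)
    have h2 := (abs_lt.1 h1).1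
    simp only [Prod.snd_add, Prod.smul_snd, smul_eq_mul]
    linarith⟩

/-- The infinitesimal generator `χ` of the geodesic flow, `χ_{(x,v)} = (v, x)`; it is the velocity
of the flow by `hasDerivAt_flow`. -/
def generator (z : UT n) : z.T :=
  z.tangentEquiv.symm ⟨(z.vec, z.pt), by
    refine ⟨z.mink_pt_vec, z.mink_vec_pt, ?_⟩
    rw [mink_pt_pt, mink_vec_vec]; norm_num⟩

theorem dIncl_generator (z : UT n) : z.dIncl z.generator = (z.vec, z.pt) :=
  z.dIncl_tangentEquiv_symm _

theorem hasDerivAt_flow (z : UT n) :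
    HasDerivAt (fun t => (flow t z).incl) (z.dIncl z.generator) 0 := by
  rw [dIncl_generator]
  have hc := Real.hasDerivAt_cosh 0
  have hs := Real.hasDerivAt_sinh 0
  have h := ((hc.smul_const z.pt).add (hs.smul_const z.vec)).prodMk
    ((hs.smul_const z.pt).add (hc.smul_const z.vec))
  have h' : HasDerivAt (fun t : ℝ => (Real.cosh t • z.pt + Real.sinh t • z.vec,
      Real.sinh t • z.pt + Real.cosh t • z.vec)) (z.vec, z.pt) 0 := by simpa using h
  exact h'

/-- The connector of the Levi-Civita connection of `H^{n+1}`: it sends `(ẋ, v̇)` to the covariant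
derivative, i.e. to the orthogonal projection `v̇ + ⟨x, v̇⟩ x` of `v̇` to `T_x H^{n+1} = x^⊥`. -/
def connector (z : UT n) : Mink n × Mink n →L[ℝ] Mink n :=
  .snd ℝ _ _ + ((mink n z.pt).comp (.snd ℝ _ _)).smulRight z.pt

theorem connector_apply (z : UT n) (X : Mink n × Mink n) :
    z.connector X = X.2 + mink n z.pt X.2 • z.pt := rfl

/-- The horizontal lift `u^H` of `u ∈ T_x H^{n+1}`: the velocity `(u, ⟨u, v⟩ x)` at time `0` of
`(γ(t), v(t))`, with `γ` the geodesic of initial velocity `u` and `v(t)` parallel along `γ`. -/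
def horizontalLift (z : UT n) (u : Mink n) : Mink n × Mink n := (u, mink n u z.vec • z.pt)

/-- The vertical lift `w^V = (0, w)`, for `w` tangent and orthogonal to `v`. -/
def verticalLift (w : Mink n) : Mink n × Mink n := (0, w)

theorem eq_horizontalLift_add_verticalLift (z : UT n) {X : Mink n × Mink n}
    (hX : X ∈ z.tangentModel) :
    X = z.horizontalLift X.1 + verticalLift (z.connector X) := by
  obtain ⟨-, -, h3⟩ := hX
  refine Prod.ext (by simp [horizontalLift, verticalLift]) ?_
  have : mink n X.1 z.vec = - mink n z.pt X.2 := by rw [mink_comm]; linarith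
  simp [horizontalLift, verticalLift, connector_apply, this]

/-- The para-Sasaki metric in the model: for `X = u₁^H + w₁^V` and `Y = u₂^H + w₂^V` it is
`⟨u₁, u₂⟩ - ⟨w₁, w₂⟩`, where `u` is the first component of the vector and `w` its image by the
connector. -/
def paraSasakiModel (z : UT n) : Mink n × Mink n →L[ℝ] Mink n × Mink n →L[ℝ] ℝ :=
  (mink n).bilinearComp (.fst ℝ _ _) (.fst ℝ _ _) - (mink n).bilinearComp z.connector z.connector

theorem paraSasakiModel_apply (z : UT n) (X Y : Mink n × Mink n) : z.paraSasakiModel X Y =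
    mink n X.1 Y.1 - mink n (z.connector X) (z.connector Y) := rfl

theorem paraSasakiModel_lift (z : UT n) {u₁ u₂ w₁ w₂ : Mink n}
    (hw₁ : mink n z.pt w₁ = 0) (hw₂ : mink n z.pt w₂ = 0) :
    z.paraSasakiModel (z.horizontalLift u₁) (z.horizontalLift u₂) = mink n u₁ u₂ ∧
    z.paraSasakiModel (verticalLift w₁) (verticalLift w₂) = - mink n w₁ w₂ ∧
    z.paraSasakiModel (z.horizontalLift u₁) (verticalLift w₂) = 0 := by
  simp [paraSasakiModel_apply, connector_apply, horizontalLift, verticalLift, mink_pt_pt, hw₁, hw₂]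

/-- The para-Sasaki metric `g` on `T^1 H^{n+1}`. -/
def paraSasaki (z : UT n) : z.T →ₗ[ℝ] z.T →ₗ[ℝ] ℝ :=
  LinearMap.mk₂ ℝ (fun X Y => z.paraSasakiModel (z.dIncl X) (z.dIncl Y))
    (by intros; simp) (by intros; simp) (by intros; simp) (by intros; simp)

theorem paraSasaki_apply (z : UT n) (X Y : z.T) :
    z.paraSasaki X Y = z.paraSasakiModel (z.dIncl X) (z.dIncl Y) := rfl

/-- The connection form `ω = g(·, χ)`. -/
def connection (n : ℕ) : DForm (model n) (UT n) 1 := fun z =>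
  ContinuousAlternatingMap.ofSubsingleton ℝ z.T ℝ 0
    (LinearMap.toContinuousLinearMap (z.paraSasaki.flip z.generator))

theorem connection_apply (z : UT n) (X : Fin 1 → z.T) :
    connection n z X = z.paraSasaki (X 0) z.generator := rfl

/-- The `g`-orthogonal complement of `χ`. -/
def chiPerp (z : UT n) : Submodule ℝ z.T := LinearMap.ker (z.paraSasaki.flip z.generator)

theorem paraSasaki_generator (z : UT n) (X : z.T) :
    z.paraSasaki X z.generator = mink n (z.dIncl X).1 z.vec := by
  rw [paraSasaki_apply, dIncl_generator, paraSasakiModel_apply]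
  simp [connector_apply, mink_pt_pt]

theorem paraSasaki_generator_self (z : UT n) : z.paraSasaki z.generator z.generator = 1 := by
  rw [paraSasaki_generator, dIncl_generator, mink_vec_vec]

theorem mem_chiPerp (z : UT n) (X : z.T) : X ∈ z.chiPerp ↔ mink n z.vec (z.dIncl X).1 = 0 := by
  rw [chiPerp, LinearMap.mem_ker, LinearMap.flip_apply, paraSasaki_generator, mink_comm]

theorem mink_pt_of_mem_chiPerp (z : UT n) {X : z.T} (hX : X ∈ z.chiPerp) :
    mink n z.pt (z.dIncl X).2 = 0 := by
  have h := (z.dIncl_mem X).2.2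
  rw [(z.mem_chiPerp X).1 hX, add_zero] at h
  exact h

theorem finrank_chiPerp (z : UT n) : Module.finrank ℝ z.chiPerp = 2 * n := by
  have h := LinearMap.finrank_range_add_finrank_ker (z.paraSasaki.flip z.generator)
  have hs : LinearMap.range (z.paraSasaki.flip z.generator) = ⊤ := by
    rw [LinearMap.range_eq_top]
    intro c
    exact ⟨c • z.generator, by simp [paraSasaki_generator_self]⟩
  rw [hs, finrank_top, z.finrank_T, Module.finrank_self] at h
  have : Module.finrank ℝ z.chiPerp =
    Module.finrank ℝ (LinearMap.ker (z.paraSasaki.flip z.generator)) := rfl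
  omega

/-- The endomorphism `J(ẋ, v̇) = (v̇, ẋ)` of `χ^⊥`. -/
def J (z : UT n) : z.chiPerp →ₗ[ℝ] z.chiPerp where
  toFun X := ⟨z.tangentEquiv.symm ⟨((z.dIncl X).2, (z.dIncl X).1), by
      have h := z.dIncl_mem X
      have h1 := (z.mem_chiPerp X).1 X.2
      have h2 := z.mink_pt_of_mem_chiPerp X.2
      exact ⟨h2, h1, by rw [h.1, h.2.1, add_zero]⟩⟩, by
      rw [mem_chiPerp, dIncl_tangentEquiv_symm]
      exact (z.dIncl_mem X).2.1⟩
  map_add' X Y := Subtype.ext (z.dIncl_injective (by simp [dIncl_tangentEquiv_symm]))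
  map_smul' c X := Subtype.ext (z.dIncl_injective (by simp [dIncl_tangentEquiv_symm]))

theorem dIncl_J (z : UT n) (X : z.chiPerp) :
    z.dIncl (z.J X) = ((z.dIncl X).2, (z.dIncl X).1) := z.dIncl_tangentEquiv_symm _

theorem paraSasaki_J_self (z : UT n) (X : z.chiPerp) : z.paraSasaki X (z.J X) = 0 := by
  rw [paraSasaki_apply, dIncl_J, paraSasakiModel_apply, connector_apply, connector_apply,
    z.mink_pt_of_mem_chiPerp X.2, (z.dIncl_mem X).1]
  simp [mink_comm (z.dIncl X).1]

end UT

/-- The space of oriented geodesics of `H^{n+1}`, as the open set of pairs of distinct points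
(initial endpoint, final endpoint) in the product of two copies of the visual boundary `S^n`. The
point `a` of `S^n` stands for the ray of the null vector `(a, 1)`. -/
def Geod (n : ℕ) : TopologicalSpace.Opens (sphere (0 : Euc n) 1 × sphere (0 : Euc n) 1) :=
  ⟨{q | q.1 ≠ q.2}, isOpen_ne_fun continuous_fst continuous_snd⟩

/-- The model with corners of the `2n`-manifold of oriented geodesics. -/
abbrev Geod.model (n : ℕ) := (𝓡 n).prod (𝓡 n)

/-- The tangent space of the manifold of oriented geodesics. -/
abbrev Geod.T {n : ℕ} (ℓ : Geod n) : Type := TangentSpace (Geod.model n) ℓ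

instance {n : ℕ} (ℓ : Geod n) : FiniteDimensional ℝ (Geod.T ℓ) :=
  inferInstanceAs (FiniteDimensional ℝ (EuclideanSpace ℝ (Fin n) × EuclideanSpace ℝ (Fin n)))
instance {n : ℕ} (ℓ : Geod n) : T2Space (Geod.T ℓ) :=
  inferInstanceAs (T2Space (EuclideanSpace ℝ (Fin n) × EuclideanSpace ℝ (Fin n)))

theorem Geod.finrank_T {n : ℕ} (ℓ : Geod n) : Module.finrank ℝ (Geod.T ℓ) = 2 * n := by
  have : Module.finrank ℝ (EuclideanSpace ℝ (Fin n) × EuclideanSpace ℝ (Fin n)) = 2 * n := by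
    simp; ring
  exact this

theorem endpoint_mem {n : ℕ} {y : Mink n} (h : mink n y y = 0) (hy : 0 < y.2) :
    y.2⁻¹ • y.1 ∈ sphere (0 : Euc n) 1 := by
  rw [mink_apply, real_inner_self_eq_norm_sq] at h
  have h1 : ‖y.1‖ = y.2 := by nlinarith [norm_nonneg y.1]
  rw [mem_sphere_zero_iff_norm, norm_smul, norm_inv, Real.norm_of_nonneg hy.le, h1,
    inv_mul_cancel₀ hy.ne']

/-- The point of the visual boundary `S^n` given by a future null vector. -/
def endpoint {n : ℕ} (y : Mink n) (h : mink n y y = 0) (hy : 0 < y.2) : sphere (0 : Euc n) 1 :=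
  ⟨y.2⁻¹ • y.1, endpoint_mem h hy⟩

namespace UT
variable {n : ℕ}

theorem null_sub (z : UT n) : mink n (z.pt - z.vec) (z.pt - z.vec) = 0 := by
  simp [mink_pt_pt, mink_pt_vec, mink_vec_pt, mink_vec_vec]

theorem null_add (z : UT n) : mink n (z.pt + z.vec) (z.pt + z.vec) = 0 := by
  simp [mink_pt_pt, mink_pt_vec, mink_vec_pt, mink_vec_vec]

theorem endpoint_ne (z : UT n) : endpoint (z.pt - z.vec) z.null_sub z.sub_pos ≠
    endpoint (z.pt + z.vec) z.null_add z.add_pos := by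
  intro h
  have h1 : (z.pt - z.vec).2⁻¹ • (z.pt - z.vec).1 = (z.pt + z.vec).2⁻¹ • (z.pt + z.vec).1 :=
    congrArg Subtype.val h
  have hs : 0 < (z.pt - z.vec).2 := z.sub_pos
  have ha : 0 < (z.pt + z.vec).2 := z.add_pos
  have h2 : z.pt - z.vec = ((z.pt - z.vec).2 * (z.pt + z.vec).2⁻¹) • (z.pt + z.vec) := by
    refine Prod.ext ?_ ?_
    · rw [Prod.smul_fst, mul_smul, ← h1, smul_smul, mul_inv_cancel₀ hs.ne', one_smul]
    · rw [Prod.smul_snd, smul_eq_mul, mul_assoc, inv_mul_cancel₀ ha.ne', mul_one]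
  have h3 : mink n (z.pt - z.vec) (z.pt + z.vec) = 0 := by
    rw [h2, map_smul, smul_apply, null_add, smul_zero]
  simp [mink_pt_pt, mink_pt_vec, mink_vec_pt, mink_vec_vec] at h3
  norm_num at h3

/-- The projection to the space of geodesics: the geodesic `cosh t x + sinh t v` through `x` with
speed `v` has the endpoints given by the null vectors `x - v` and `x + v`. -/
def p (z : UT n) : Geod n :=
  ⟨(endpoint (z.pt - z.vec) z.null_sub z.sub_pos, endpoint (z.pt + z.vec) z.null_add z.add_pos),
    z.endpoint_ne⟩

theorem p_surjective : Function.Surjective (p (n := n)) := by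
  rintro ⟨⟨a, b⟩, hab⟩
  have hab' : (a : Euc n) ≠ b := fun h => hab (Subtype.ext h)
  have ha1 : ‖(a : Euc n)‖ = 1 := norm_eq_of_mem_sphere a
  have hb1 : ‖(b : Euc n)‖ = 1 := norm_eq_of_mem_sphere b
  have ha : inner ℝ (a : Euc n) (a : Euc n) = (1 : ℝ) := by
    rw [real_inner_self_eq_norm_sq, ha1]; norm_num
  have hb : inner ℝ (b : Euc n) (b : Euc n) = (1 : ℝ) := by
    rw [real_inner_self_eq_norm_sq, hb1]; norm_num
  have hc : inner ℝ (a : Euc n) (b : Euc n) < (1 : ℝ) := by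
    refine lt_of_le_of_ne ?_ fun h => hab' ((inner_eq_one_iff_of_norm_eq_one ha1 hb1).1 h)
    simpa [ha1, hb1] using real_inner_le_norm (a : Euc n) b
  set c : ℝ := inner ℝ (a : Euc n) (b : Euc n) with hcd
  have hba : inner ℝ (b : Euc n) (a : Euc n) = c := real_inner_comm _ _
  set s : ℝ := (√(2 * (1 - c)))⁻¹ with hs
  have hpos : 0 < 2 * (1 - c) := by linarith
  have hs0 : 0 < s := by positivity
  have hs2 : s * s * (2 * (1 - c)) = 1 := by
    rw [hs, ← mul_inv, Real.mul_self_sqrt hpos.le, inv_mul_cancel₀ hpos.ne']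
  refine ⟨⟨((s • ((a : Euc n) + b), 2 * s), (s • ((b : Euc n) - a), 0)), ?_⟩, ?_⟩
  · simp only [mink_apply, inner_add_left, inner_add_right, inner_sub_left, inner_sub_right,
      inner_smul_left, inner_smul_right, conj_trivial, ha, hb, ← hcd, hba]
    exact ⟨⟨by linarith, by positivity⟩, by ring, by linarith⟩
  · refine Subtype.ext (Prod.ext (Subtype.ext ?_) (Subtype.ext ?_))
    · change (2 * s - 0)⁻¹ • (s • ((a : Euc n) + b) - s • ((b : Euc n) - a)) = a
      rw [← smul_sub, smul_smul, sub_zero, show (a : Euc n) + b - (b - a) = (2 : ℝ) • (a : Euc n) by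
        rw [two_smul]; abel, smul_smul, show (2 * s)⁻¹ * s * 2 = 1 by field_simp, one_smul]
    · change (2 * s + 0)⁻¹ • (s • ((a : Euc n) + b) + s • ((b : Euc n) - a)) = b
      rw [← smul_add, smul_smul, add_zero, show (a : Euc n) + b + (b - a) = (2 : ℝ) • (b : Euc n) by
        rw [two_smul]; abel, smul_smul, show (2 * s)⁻¹ * s * 2 = 1 by field_simp, one_smul]

/-- The initial endpoint of a geodesic, as a map on the ambient space. -/
def endMinus (w : Mink n × Mink n) : Euc n := (w.1.2 - w.2.2)⁻¹ • (w.1.1 - w.2.1)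
/-- The final endpoint of a geodesic, as a map on the ambient space. -/
def endPlus (w : Mink n × Mink n) : Euc n := (w.1.2 + w.2.2)⁻¹ • (w.1.1 + w.2.1)

theorem hasFDerivAt_inv_smul {V : Type*} [NormedAddCommGroup V] [NormedSpace ℝ V]
    (L : V →L[ℝ] ℝ) (N : V →L[ℝ] Euc n) (w : V) (hw : L w ≠ 0) :
    HasFDerivAt (fun w => (L w)⁻¹ • N w)
      ((L w)⁻¹ • N + ((-(L w ^ 2)⁻¹) • L).smulRight (N w)) w :=
  ((hasDerivAt_inv hw).comp_hasFDerivAt w L.hasFDerivAt).smul N.hasFDerivAt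

theorem contDiffAt_endMinus (z : UT n) : ContDiffAt ℝ ∞ endMinus z.incl := by
  have : z.incl.1.2 - z.incl.2.2 ≠ 0 := z.sub_pos.ne'
  unfold endMinus
  exact ((contDiffAt_fst.snd.sub contDiffAt_snd.snd).inv this).smul
    (contDiffAt_fst.fst.sub contDiffAt_snd.fst)

theorem contDiffAt_endPlus (z : UT n) : ContDiffAt ℝ ∞ endPlus z.incl := by
  have : z.incl.1.2 + z.incl.2.2 ≠ 0 := z.add_pos.ne'
  unfold endPlus
  exact ((contDiffAt_fst.snd.add contDiffAt_snd.snd).inv this).smul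
    (contDiffAt_fst.fst.add contDiffAt_snd.fst)

theorem contMDiff_p : ContMDiff (model n) (Geod.model n) ∞ (p (n := n)) := by
  have hF : Fact (Module.finrank ℝ (Euc n) = n + 1) := ⟨finrank_euclideanSpace_fin⟩
  have hm : ContMDiff (model n) 𝓘(ℝ, Euc n) ∞ (endMinus ∘ incl (n := n)) := fun z =>
    ContMDiffAt.comp z z.contDiffAt_endMinus.contMDiffAt (contMDiff_incl z)
  have hp : ContMDiff (model n) 𝓘(ℝ, Euc n) ∞ (endPlus ∘ incl (n := n)) := fun z =>
    ContMDiffAt.comp z z.contDiffAt_endPlus.contMDiffAt (contMDiff_incl z)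
  have hm0 : ∀ z : UT n, (endMinus ∘ incl) z ∈ sphere (0 : Euc n) 1 :=
    fun z => by
      have e : (endMinus ∘ incl) z = (z.pt - z.vec).2⁻¹ • (z.pt - z.vec).1 := rfl
      rw [e]
      exact endpoint_mem z.null_sub z.sub_pos
  have hp0 : ∀ z : UT n, (endPlus ∘ incl) z ∈ sphere (0 : Euc n) 1 :=
    fun z => by
      have e : (endPlus ∘ incl) z = (z.pt + z.vec).2⁻¹ • (z.pt + z.vec).1 := rfl
      rw [e]
      exact endpoint_mem z.null_add z.add_pos
  have hm' : ContMDiff (model n) (𝓡 n) ∞ (fun z : UT n => z.p.1.1) :=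
    ContMDiff.codRestrict_sphere (n := n) hm hm0
  have hp' : ContMDiff (model n) (𝓡 n) ∞ (fun z : UT n => z.p.1.2) :=
    ContMDiff.codRestrict_sphere (n := n) hp hp0
  have h : ContMDiff (model n) (Geod.model n) ∞ (Subtype.val ∘ p (n := n)) := hm'.prodMk hp'
  exact (ContMDiff.subtypeVal_comp_iff (I := model n) (I' := Geod.model n) (Geod n) p).1 h

/-- The differential of `p`. -/
def dp (z : UT n) : z.T →L[ℝ] Geod.T z.p := mfderiv (model n) (Geod.model n) p z

theorem dp_eq_zero (z : UT n) {X : z.T} (hX : z.dp X = 0) :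
    fderiv ℝ endMinus z.incl (z.dIncl X) = 0 ∧ fderiv ℝ endPlus z.incl (z.dIncl X) = 0 := by
  have hF : Fact (Module.finrank ℝ (Euc n) = n + 1) := ⟨finrank_euclideanSpace_fin⟩
  have hdm : DifferentiableAt ℝ endMinus z.incl :=
    z.contDiffAt_endMinus.differentiableAt (by simp)
  have hdp : DifferentiableAt ℝ endPlus z.incl :=
    z.contDiffAt_endPlus.differentiableAt (by simp)
  have key : ∀ f : Geod n → Euc n, ContMDiff (Geod.model n) 𝓘(ℝ, Euc n) ∞ f →
      mvfderiv (model n) (f ∘ p) z X = 0 := by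
    intro f hf
    have hc := HasMFDerivAt.comp z (hf.mdifferentiable (by simp) z.p).hasMFDerivAt
      (contMDiff_p.mdifferentiable (by simp) z).hasMFDerivAt
    have h := congrArg (fun f => f X) hc.mfderiv
    refine h.trans ?_
    exact (congrArg (mfderiv (Geod.model n) 𝓘(ℝ, Euc n) f z.p) hX).trans (map_zero _)
  have hcoe : ContMDiff (𝓡 n) 𝓘(ℝ, Euc n) ∞ ((↑) : sphere (0 : Euc n) 1 → Euc n) :=
    contMDiff_coe_sphere
  have hval : ContMDiff (Geod.model n) (Geod.model n) ∞ (Subtype.val : Geod n → _) :=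
    contMDiff_subtype_val
  constructor
  · rw [← mvfderiv_comp_incl z hdm.hasFDerivAt X]
    exact key _ (hcoe.comp (contMDiff_fst.comp hval))
  · rw [← mvfderiv_comp_incl z hdp.hasFDerivAt X]
    exact key _ (hcoe.comp (contMDiff_snd.comp hval))

theorem exists_smul_of_fderiv_eq_zero {V : Type*} [NormedAddCommGroup V] [NormedSpace ℝ V]
    (A : V →L[ℝ] Mink n) (w X : V) (hw : (A w).2 ≠ 0)
    (h : fderiv ℝ (fun w => (A w).2⁻¹ • (A w).1) w X = 0) : ∃ c : ℝ, A X = c • A w := by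
  have hd := hasFDerivAt_inv_smul ((ContinuousLinearMap.snd ℝ _ _).comp A)
    ((ContinuousLinearMap.fst ℝ _ _).comp A) w hw
  have h' := (congrArg (fun f => f X) hd.fderiv).symm.trans h
  have h2 : (A w).2⁻¹ • (A X).1 + (-((A w).2 ^ 2)⁻¹ * (A X).2) • (A w).1 = 0 := h'
  refine ⟨(A X).2 * (A w).2⁻¹, Prod.ext ?_ ?_⟩
  · have h3 := congrArg (fun y => (A w).2 • y) h2
    simp only [smul_add, smul_smul, smul_zero, mul_inv_cancel₀ hw, one_smul] at h3
    rw [Prod.smul_fst, eq_neg_of_add_eq_zero_left h3, ← neg_smul]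
    congr 1
    field_simp
  · rw [Prod.smul_snd, smul_eq_mul, mul_assoc, inv_mul_cancel₀ hw, mul_one]

theorem dp_injective_of_mem_chiPerp (z : UT n) {X : z.T} (hX : X ∈ z.chiPerp) (h : z.dp X = 0) :
    X = 0 := by
  obtain ⟨hm, hp⟩ := z.dp_eq_zero h
  obtain ⟨c, hc⟩ := exists_smul_of_fderiv_eq_zero
    (ContinuousLinearMap.fst ℝ (Mink n) (Mink n) - ContinuousLinearMap.snd ℝ (Mink n) (Mink n))
    z.incl (z.dIncl X) z.sub_pos.ne' hm
  obtain ⟨d, hd⟩ := exists_smul_of_fderiv_eq_zero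
    (ContinuousLinearMap.fst ℝ (Mink n) (Mink n) + ContinuousLinearMap.snd ℝ (Mink n) (Mink n))
    z.incl (z.dIncl X) z.add_pos.ne' hp
  have hc' : (z.dIncl X).1 - (z.dIncl X).2 = c • (z.pt - z.vec) := hc
  have hd' : (z.dIncl X).1 + (z.dIncl X).2 = d • (z.pt + z.vec) := hd
  obtain ⟨t1, t2, -⟩ := z.dIncl_mem X
  have t3 := (z.mem_chiPerp X).1 hX
  have t4 := z.mink_pt_of_mem_chiPerp hX
  have e1 := congrArg (mink n z.pt) hc'
  have e2 := congrArg (mink n z.pt) hd'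
  simp only [map_sub, map_add, map_smul, t1, t4, mink_pt_pt, mink_pt_vec, smul_eq_mul] at e1 e2
  have hc0 : c = 0 := by linarith
  have hd0 : d = 0 := by linarith
  rw [hc0, zero_smul] at hc'
  rw [hd0, zero_smul] at hd'
  refine z.dIncl_injective ?_
  rw [map_zero]
  have h12 := sub_eq_zero.1 hc'
  rw [h12, ← two_smul ℝ] at hd'
  have h20 : (z.dIncl X).2 = 0 := (smul_eq_zero.1 hd').resolve_left two_ne_zero
  exact Prod.ext (h12.trans h20) h20

/-- The differential of `p` restricts to an isomorphism of `χ^⊥` to the tangent space of the space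
of geodesics. -/
def horizontalEquiv (z : UT n) : z.chiPerp ≃L[ℝ] Geod.T z.p :=
  (LinearEquiv.ofBijective (z.dp.toLinearMap.domRestrict z.chiPerp) <| by
    have hi : Function.Injective (z.dp.toLinearMap.domRestrict z.chiPerp) := by
      rw [injective_iff_map_eq_zero]
      intro X hX
      exact Subtype.ext (z.dp_injective_of_mem_chiPerp X.2 hX)
    exact ⟨hi, (LinearMap.injective_iff_surjective_of_finrank_eq_finrank
      (z.finrank_chiPerp.trans (Geod.finrank_T z.p).symm)).1 hi⟩).toContinuousLinearEquiv

/-- The same isomorphism, with the geodesic `p z` written as `ℓ`. -/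
def horizontalEquivAt (z : UT n) {ℓ : Geod n} (h : z.p = ℓ) : z.chiPerp ≃ₗ[ℝ] Geod.T ℓ :=
  h ▸ z.horizontalEquiv.toLinearEquiv

theorem horizontalEquiv_apply (z : UT n) (X : z.chiPerp) : z.horizontalEquiv X = z.dp X := rfl

end UT

namespace Geod
variable {n : ℕ}

/-- A unit tangent vector of the geodesic `ℓ` (any choice). -/
def lift (ℓ : Geod n) : UT n := Function.surjInv UT.p_surjective ℓ

theorem p_lift (ℓ : Geod n) : (lift ℓ).p = ℓ := Function.surjInv_eq UT.p_surjective ℓ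

/-- The inverse of the isomorphism `dp : χ^⊥ → T_ℓ`, at the chosen unit tangent vector. -/
def tangentLift (ℓ : Geod n) : T ℓ ≃ₗ[ℝ] (lift ℓ).chiPerp :=
  ((lift ℓ).horizontalEquivAt (p_lift ℓ)).symm

/-- The metric `𝔾`, push-forward by `dp` of the restriction of `g` to `χ^⊥`. -/
def metric (ℓ : Geod n) : T ℓ →ₗ[ℝ] T ℓ →ₗ[ℝ] ℝ :=
  ((lift ℓ).paraSasaki.domRestrict₁₂ (lift ℓ).chiPerp (lift ℓ).chiPerp).compl₁₂
    (tangentLift ℓ).toLinearMap (tangentLift ℓ).toLinearMap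

/-- The para-complex structure `𝕁`, push-forward by `dp` of the endomorphism `J` of `χ^⊥`. -/
def paraComplex (ℓ : Geod n) : T ℓ →ₗ[ℝ] T ℓ :=
  (tangentLift ℓ).symm.toLinearMap ∘ₗ (lift ℓ).J ∘ₗ (tangentLift ℓ).toLinearMap

theorem metric_paraComplex_self (ℓ : Geod n) (A : T ℓ) : metric ℓ A (paraComplex ℓ A) = 0 := by
  simp only [metric, paraComplex, LinearMap.compl₁₂_apply,
    LinearMap.domRestrict₁₂_apply, LinearMap.comp_apply, LinearEquiv.coe_coe, LinearEquiv.apply_symm_apply]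
  exact (lift ℓ).paraSasaki_J_self _

/-- The fundamental form `Ω = 𝔾(·, 𝕁 ·)`. -/
def symplecticForm (n : ℕ) : DForm (model n) (Geod n) 2 := fun ℓ =>
  twoForm ((metric ℓ).compl₂ (paraComplex ℓ)) (metric_paraComplex_self ℓ)

theorem symplecticForm_apply (ℓ : Geod n) (A : Fin 2 → T ℓ) : symplecticForm n ℓ A =
    metric ℓ (A 0) (paraComplex ℓ (A 1)) := rfl

end Geod

end GeodesicSpace

end

/-! Every form in the theorem is the restriction of a simple form on the linear space of pairs `(x,
v)`. Since `χ = (v, x)` is the horizontal lift of `v`, the connection form is the restriction of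
`⟨v, dx⟩`. Its coefficients are linear, so its exterior derivative is constant, namely
`-ambientForm`. As exterior derivatives commute with pullback, `dω` is the restriction of
`-ambientForm` to the unit tangent bundle.

On `χ^⊥` one has `⟨x, v̇⟩ = 0`, so `g` becomes `⟨ẋ₁, ẋ₂⟩ - ⟨v̇₁, v̇₂⟩`, and inserting the swap `J`
in the second slot gives exactly `ambientForm`. The flow is the restriction of a linear map mixing
`x` and `v` by `cosh t`, `sinh t`. This map preserves that difference, because `cosh² - sinh² = 1`,
and commutes with the swap. As the fibres of `p` are the orbits, `𝔾` and `𝕁` are independent of the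
lift. The generator lies in the kernel of `ambientForm` on each tangent space, so `p^*Ω` is the
restriction of `ambientForm` (`formPullback_p_symplecticForm`), and the curvature identity follows.

The bundle has a global smooth section, the point of a geodesic closest to the origin. Pulling
`p^*Ω` back along it presents `Ω` as the pullback of a constant form by a smooth map, hence smooth
and closed. Non-degeneracy comes from the positivity of the Minkowski form on `x^⊥`: pairing `(ẋ,
v̇)` with `(-v̇, ẋ)` gives `⟨ẋ, ẋ⟩ + ⟨v̇, v̇⟩`. -/

open Metric
open scoped Manifold ContDiff
noncomputable section
namespace GeodesicSpace

/-! ### Smooth dependence of pullbacks of alternating maps -/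

section Alternating
variable {E F : Type*} [NormedAddCommGroup E] [NormedSpace ℝ E]
  [NormedAddCommGroup F] [NormedSpace ℝ F] {k : ℕ}

/-- The normalised alternatization, a continuous linear projection of the multilinear maps to the
alternating ones. -/
def alternatizationCLM (E : Type*) [NormedAddCommGroup E] [NormedSpace ℝ E] (k : ℕ) :
    ContinuousMultilinearMap ℝ (fun _ : Fin k => E) ℝ →L[ℝ] E [⋀^Fin k]→L[ℝ] ℝ :=
  LinearMap.mkContinuous
    { toFun := fun f => (k.factorial : ℝ)⁻¹ • f.alternatization
      map_add' := fun f g => by rw [map_add, smul_add]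
      map_smul' := fun c f => by
        ext v
        change (k.factorial : ℝ)⁻¹ • ContinuousMultilinearMap.alternatization (c • f) v =
          c • (k.factorial : ℝ)⁻¹ • ContinuousMultilinearMap.alternatization f v
        simp only [ContinuousMultilinearMap.alternatization_apply_apply,
          smul_apply]
        rw [smul_comm c, Finset.smul_sum (r := c)]
        simp only [smul_comm c] } 1 <| by
    intro f
    refine ContinuousAlternatingMap.opNorm_le_bound _ (by positivity) fun v => ?_
    -- Each of the `k!` permutations contributes at most `‖f‖ ∏ ‖v i‖`, which the normalising factor
    -- cancels; this is why the norm bound is `1`.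
    have h : ‖ContinuousMultilinearMap.alternatization f v‖ ≤
        k.factorial * (‖f‖ * ∏ i, ‖v i‖) := by
      rw [ContinuousMultilinearMap.alternatization_apply_apply]
      refine (norm_sum_le _ _).trans ?_
      refine (Finset.sum_le_sum (g := fun _ => ‖f‖ * ∏ i, ‖v i‖) fun σ _ => ?_).trans (by
        simp [Fintype.card_perm])
      have h1 : ‖Equiv.Perm.sign σ • f (v ∘ σ)‖ = ‖f (v ∘ σ)‖ := by
        rcases Int.units_eq_one_or (Equiv.Perm.sign σ) with h | h <;> simp [h]
      rw [h1]
      refine (f.le_opNorm _).trans_eq ?_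
      congr 1
      exact Equiv.prod_comp σ fun i => ‖v i‖
    change ‖(k.factorial : ℝ)⁻¹ • ContinuousMultilinearMap.alternatization f v‖ ≤ _
    rw [norm_smul, norm_inv, Real.norm_natCast, one_mul]
    rwa [inv_mul_le_iff₀ (by positivity)]

theorem alternatizationCLM_coe (f : E [⋀^Fin k]→L[ℝ] ℝ) :
    alternatizationCLM E k f.toContinuousMultilinearMap = f := by
  ext v
  change (k.factorial : ℝ)⁻¹ •
    ContinuousMultilinearMap.alternatization f.toContinuousMultilinearMap v = f v
  have h : ∀ σ : Equiv.Perm (Fin k),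
      Equiv.Perm.sign σ • f.toContinuousMultilinearMap (v ∘ σ) = f v := fun σ => by
    have := f.toAlternatingMap.map_perm v σ
    change Equiv.Perm.sign σ • f.toAlternatingMap (v ∘ σ) = f.toAlternatingMap v
    rw [this, smul_smul, Int.units_mul_self, one_smul]
  rw [ContinuousMultilinearMap.alternatization_apply_apply, Finset.sum_congr rfl fun σ _ => h σ]
  simp [Fintype.card_perm, Nat.factorial_ne_zero]

/-- For multilinear maps, precomposition is continuous multilinear in the linear maps and linear in
the form, hence smooth. `alternatizationCLM` fixes alternating maps, so it brings this smoothness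
back to the space of alternating maps. -/
theorem ContDiffWithinAt.compContinuousLinearMap {X : Type*} [NormedAddCommGroup X]
    [NormedSpace ℝ X] {g : X → F [⋀^Fin k]→L[ℝ] ℝ} {f : X → E →L[ℝ] F} {s : Set X} {x : X}
    {m : ℕ∞ω} (hg : ContDiffWithinAt ℝ m g s x) (hf : ContDiffWithinAt ℝ m f s x) :
    ContDiffWithinAt ℝ m (fun y => (g y).compContinuousLinearMap (f y)) s x := by
  have h1 : ContDiffWithinAt ℝ m (fun y =>
      ContinuousMultilinearMap.compContinuousLinearMapContinuousMultilinear ℝ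
        (fun _ : Fin k => E) (fun _ : Fin k => F) ℝ (fun _ => f y)) s x :=
    (ContinuousMultilinearMap.contDiff _).contDiffAt.comp_contDiffWithinAt x
      (contDiffWithinAt_pi.2 fun _ => hf)
  have h2 : ContDiffWithinAt ℝ m (fun y => (g y).toContinuousMultilinearMap) s x :=
    (ContinuousAlternatingMap.toContinuousMultilinearMapCLM (𝕜 := ℝ) (E := F) (F := ℝ)
      (ι := Fin k) ℝ).contDiff.contDiffAt.comp_contDiffWithinAt x hg
  have h3 := (alternatizationCLM E k).contDiff.contDiffAt.comp_contDiffWithinAt x (h1.clm_apply h2)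
  refine h3.congr_of_eventuallyEq ?_ ?_
  · exact Filter.Eventually.of_forall fun y =>
      (alternatizationCLM_coe ((g y).compContinuousLinearMap (f y))).symm
  · exact (alternatizationCLM_coe ((g x).compContinuousLinearMap (f x))).symm

end Alternating

/-! ### Pullback of forms from a vector space to a manifold -/

section Pullback
variable {E : Type*} [NormedAddCommGroup E] [NormedSpace ℝ E] {H : Type*} [TopologicalSpace H]
  {I : ModelWithCorners ℝ E H} {M : Type*} [TopologicalSpace M] [ChartedSpace H M]
  {E' : Type*} [NormedAddCommGroup E'] [NormedSpace ℝ E'] {H' : Type*} [TopologicalSpace H']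
  {I' : ModelWithCorners ℝ E' H'} {M' : Type*} [TopologicalSpace M'] [ChartedSpace H' M']
  {E'' : Type*} [NormedAddCommGroup E''] [NormedSpace ℝ E''] {H'' : Type*} [TopologicalSpace H'']
  {I'' : ModelWithCorners ℝ E'' H''} {M'' : Type*} [TopologicalSpace M''] [ChartedSpace H'' M'']
  {V : Type*} [NormedAddCommGroup V] [NormedSpace ℝ V] {k : ℕ}

theorem formPullback_comp {f : M → M'} {g : M' → M''} (hg : MDifferentiable I' I'' g)
    (hf : MDifferentiable I I' f) (η : DForm I'' M'' k) :
    formPullback I I'' (g ∘ f) η = formPullback I I' f (formPullback I' I'' g η) := by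
  funext x
  have h := mfderiv_comp x (hg (f x)) (hf x)
  simp only [formPullback, h]
  rfl

theorem formPullback_id (η : DForm I M k) : formPullback I I id η = η := by
  funext x
  simp only [formPullback, mfderiv_id]
  rfl

theorem contDiffOn_comp_extChartAt_symm [IsManifold I ∞ M] {F : M → V}
    (hF : ContMDiff I 𝓘(ℝ, V) ∞ F) (x₀ : M) :
    ContDiffOn ℝ ∞ (F ∘ (extChartAt I x₀).symm) (extChartAt I x₀).target :=
  contMDiffOn_iff_contDiffOn.1 (hF.comp_contMDiffOn (contMDiffOn_extChartAt_symm x₀))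

/-- Chain rule: in a chart, pulling back by `F` is the Euclidean pullback by `F` composed with the
inverse chart. Without boundary the derivative within `range I` is the plain one. -/
theorem formInChart_formPullback [IsManifold I ∞ M] [I.Boundaryless] {F : M → V}
    (hF : ContMDiff I 𝓘(ℝ, V) ∞ F) (η : V → V [⋀^Fin k]→L[ℝ] ℝ) (x₀ : M) {y : E}
    (hy : y ∈ (extChartAt I x₀).target) :
    formInChart I (formPullback I 𝓘(ℝ, V) F η) x₀ y =
      (η ((F ∘ (extChartAt I x₀).symm) y)).compContinuousLinearMap
        (fderiv ℝ (F ∘ (extChartAt I x₀).symm) y) := by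
  have hs : MDifferentiableAt 𝓘(ℝ, E) I (extChartAt I x₀).symm y :=
    ((contMDiffOn_extChartAt_symm (n := ∞) x₀).contMDiffAt
      ((isOpen_extChartAt_target x₀).mem_nhds hy)).mdifferentiableAt (by simp)
  have h := mfderiv_comp y (hF.mdifferentiable (by simp) ((extChartAt I x₀).symm y)) hs
  rw [mfderiv_eq_fderiv] at h
  rw [formInChart, I.range_eq_univ, mfderivWithin_univ, h]
  rfl

theorem smoothForm_formPullback [IsManifold I ∞ M] [I.Boundaryless] {F : M → V}
    (hF : ContMDiff I 𝓘(ℝ, V) ∞ F) {η : V → V [⋀^Fin k]→L[ℝ] ℝ} (hη : ContDiff ℝ ∞ η) :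
    SmoothForm I (formPullback I 𝓘(ℝ, V) F η) := by
  intro x₀
  have hG := contDiffOn_comp_extChartAt_symm hF x₀
  refine ContDiffOn.congr (fun y hy => ?_) fun y hy => formInChart_formPullback hF η x₀ hy
  exact ContDiffWithinAt.compContinuousLinearMap
    (hη.contDiffAt.comp_contDiffWithinAt y (hG y hy))
    ((hG.fderiv_of_isOpen (m := ∞) (isOpen_extChartAt_target x₀) (by simp)) y hy)

/-- Naturality of the exterior derivative. The chart reduces it to `extDeriv_pullback` between
normed spaces, and the chain rule reassembles the differential of `F`. -/
theorem extD_formPullback [IsManifold I ∞ M] [I.Boundaryless] {F : M → V}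
    (hF : ContMDiff I 𝓘(ℝ, V) ∞ F) {η : V → V [⋀^Fin k]→L[ℝ] ℝ} (hη : ContDiff ℝ ∞ η) :
    extD I (formPullback I 𝓘(ℝ, V) F η) = formPullback I 𝓘(ℝ, V) F (extDeriv η) := by
  funext x
  have hx := mem_extChartAt_target (I := I) x
  have hn := (isOpen_extChartAt_target (I := I) x).mem_nhds hx
  have hG : ContDiffAt ℝ ∞ (F ∘ (extChartAt I x).symm) (extChartAt I x x) :=
    (contDiffOn_comp_extChartAt_symm hF x).contDiffAt hn
  have he : formInChart I (formPullback I 𝓘(ℝ, V) F η) x =ᶠ[nhds (extChartAt I x x)] fun y =>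
      (η ((F ∘ (extChartAt I x).symm) y)).compContinuousLinearMap
        (fderiv ℝ (F ∘ (extChartAt I x).symm) y) := by
    filter_upwards [hn] with y hy using formInChart_formPullback hF η x hy
  have hFx : (F ∘ (extChartAt I x).symm) (extChartAt I x x) = F x :=
    congrArg F (extChartAt_to_inv x)
  have hc : MDifferentiableAt I 𝓘(ℝ, E) (extChartAt I x) x :=
    (contMDiffAt_extChartAt (n := ∞)).mdifferentiableAt (by simp)
  have hGd : MDifferentiableAt 𝓘(ℝ, E) 𝓘(ℝ, V) (F ∘ (extChartAt I x).symm) (extChartAt I x x) :=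
    (hG.differentiableAt (by simp)).mdifferentiableAt
  have hcomp := mfderiv_comp x hGd hc
  -- The chart and its inverse cancel only on the chart's source, which suffices for the
  -- differential at `x`.
  have hloc : (F ∘ (extChartAt I x).symm) ∘ extChartAt I x =ᶠ[nhds x] F := by
    filter_upwards [extChartAt_source_mem_nhds (I := I) x] with y hy
    exact congrArg F ((extChartAt I x).left_inv hy)
  rw [hloc.mfderiv_eq, mfderiv_eq_fderiv] at hcomp
  rw [extD, I.range_eq_univ, extDerivWithin_univ, he.extDeriv_eq,
    extDeriv_pullback (hη.differentiable (by simp) _) hG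
      (by simp [minSmoothness_of_isRCLikeNormedField]; exact ENat.LEInfty.out), hFx]
  refine Eq.trans ?_ (congrArg (extDeriv η (F x)).compContinuousLinearMap hcomp).symm
  rfl

end Pullback

/-! ### The connection form as the restriction of an ambient form -/

namespace UT
variable {n : ℕ}

/-- The one-form `⟨v, ẋ⟩` on the ambient space, whose restriction is the connection form. -/
def ambientConnection (n : ℕ) (w : Mink n × Mink n) : (Mink n × Mink n) [⋀^Fin 1]→L[ℝ] ℝ :=
  ContinuousAlternatingMap.ofSubsingleton ℝ _ ℝ 0
    (((mink n) w.2).comp (ContinuousLinearMap.fst ℝ _ _))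

theorem ambientConnection_apply (w : Mink n × Mink n) (X : Fin 1 → Mink n × Mink n) :
    ambientConnection n w X = mink n w.2 (X 0).1 := rfl

theorem contDiff_ambientConnection : ContDiff ℝ ∞ (ambientConnection n) := by
  have h : IsLinearMap ℝ (ambientConnection n) :=
    ⟨fun w w' => by ext X; simp [ambientConnection_apply],
      fun c w => by ext X; simp [ambientConnection_apply]⟩
  exact (LinearMap.toContinuousLinearMap h.mk').contDiff

theorem alternating_bilin (X : Mink n × Mink n) :
    ((mink n).bilinearComp (.fst ℝ (Mink n) (Mink n)) (.snd ℝ (Mink n) (Mink n)) -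
      (mink n).bilinearComp (.snd ℝ (Mink n) (Mink n)) (.fst ℝ (Mink n) (Mink n))) X X = 0 := by
  simp [mink_comm X.1]

/-- The constant symplectic form `⟨ẋ₁, v̇₂⟩ - ⟨v̇₁, ẋ₂⟩` on the ambient space. -/
def ambientForm (n : ℕ) : (Mink n × Mink n) [⋀^Fin 2]→L[ℝ] ℝ :=
  twoForm (ContinuousLinearMap.coeLM ℝ ∘ₗ
    ((mink n).bilinearComp (.fst ℝ (Mink n) (Mink n)) (.snd ℝ (Mink n) (Mink n)) -
      (mink n).bilinearComp (.snd ℝ (Mink n) (Mink n)) (.fst ℝ (Mink n) (Mink n))).toLinearMap)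
    alternating_bilin

theorem ambientForm_apply (X : Fin 2 → Mink n × Mink n) :
    ambientForm n X = mink n (X 0).1 (X 1).2 - mink n (X 0).2 (X 1).1 := rfl

/-- Differentiating the linear coefficient `v` of `⟨v, dx⟩` gives `⟨v̇₁, ẋ₂⟩ - ⟨v̇₂, ẋ₁⟩`. The minus
sign in the curvature identity originates here. -/
theorem extDeriv_ambientConnection (w : Mink n × Mink n) :
    extDeriv (ambientConnection n) w = -ambientForm n := by
  ext X
  have hd : ∀ Y, HasFDerivAt (fun w' : Mink n × Mink n => mink n w'.2 Y)
      (((mink n).flip Y).comp (.snd ℝ _ _)) w := fun Y =>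
    (((mink n).flip Y).comp (.snd ℝ (Mink n) (Mink n))).hasFDerivAt
  rw [extDeriv_apply (contDiff_ambientConnection.differentiable (by simp) w)]
  simp only [ambientConnection_apply, (hd _).fderiv]
  simp [Fin.removeNth, ambientForm_apply, mink_comm (X 1).2]
  ring

/-- The connector annihilates `χ`, which is horizontal, so only `⟨ẋ, v⟩` survives in `g(·, χ)`. -/
theorem connection_eq_formPullback :
    connection n = formPullback (model n) 𝓘(ℝ, Mink n × Mink n) incl (ambientConnection n) := by
  funext z
  ext X
  rw [connection_apply, paraSasaki_generator, mink_comm]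
  rfl

theorem extD_connection : extD (model n) (connection n) =
    formPullback (model n) 𝓘(ℝ, Mink n × Mink n) incl (fun _ => -ambientForm n) := by
  rw [connection_eq_formPullback, extD_formPullback contMDiff_incl contDiff_ambientConnection]
  congr 1
  exact funext extDeriv_ambientConnection

theorem smoothForm_connection : SmoothForm (model n) (connection n) := by
  rw [connection_eq_formPullback]
  exact smoothForm_formPullback contMDiff_incl contDiff_ambientConnection

theorem connection_generator (z : UT n) : connection n z (fun _ => z.generator) = 1 := by
  rw [connection_apply, paraSasaki_generator_self]

/-! ### Smooth maps into the unit tangent bundle and the geodesic flow -/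

section Smooth
variable {E : Type*} [NormedAddCommGroup E] [NormedSpace ℝ E] {H : Type*} [TopologicalSpace H]
  {I : ModelWithCorners ℝ E H} {M : Type*} [TopologicalSpace M] [ChartedSpace H M] [IsManifold I ∞ M]

/-- The universal property of a submanifold. The charts come from `trivialization`, whose two
components are given by ambient formulas, smooth because `1 + x_{n+2}` does not vanish. -/
theorem contMDiff_of_incl {f : M → UT n} (hf : ContMDiff I 𝓘(ℝ, Mink n × Mink n) ∞ (incl ∘ f)) :
    ContMDiff I (model n) ∞ f := by
  have hF : Fact (Module.finrank ℝ (Euc n) = n + 1) := ⟨finrank_euclideanSpace_fin⟩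
  have h1 : ContMDiff I 𝓘(ℝ, Euc n) ∞ (fun x => (f x).pt.1) :=
    (ContinuousLinearMap.fst ℝ (Euc n) ℝ ∘L
      ContinuousLinearMap.fst ℝ (Mink n) (Mink n)).contMDiff.comp hf
  have h2 : ContMDiff I 𝓘(ℝ, Euc n) ∞ (fun x => (f x).frame) := fun x => by
    have : (1 : ℝ) + (f x).incl.1.2 ≠ 0 := by
      have := (f x).pt_pos
      exact (by positivity : (1 : ℝ) + (f x).pt.2 ≠ 0)
    have hq : ContDiffAt ℝ ∞ (fun w : Mink n × Mink n => w.2.1 - (w.2.2 / (1 + w.1.2)) • w.1.1)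
        (f x).incl := by
      fun_prop (disch := assumption)
    exact ContMDiffAt.comp (g := fun w : Mink n × Mink n => w.2.1 - (w.2.2 / (1 + w.1.2)) • w.1.1)
      (f := incl ∘ f) x hq.contMDiffAt (hf x)
  have h3 : ContMDiff I (𝓡 n) ∞ (fun x => (⟨(f x).frame, (f x).frame_mem⟩ :
      sphere (0 : Euc n) 1)) := ContMDiff.codRestrict_sphere (n := n) h2 fun x => (f x).frame_mem
  have h4 : ContMDiff I (model n) ∞ (trivialization n ∘ f) := h1.prodMk h3
  have h5 := contMDiff_trivialization_symm.comp h4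
  rwa [← Function.comp_assoc, show (trivialization n).symm ∘ trivialization n = id from
    funext (trivialization n).symm_apply_apply] at h5

end Smooth

/-- The linear map of the ambient space that restricts to the geodesic flow. -/
def flowCLM (n : ℕ) (t : ℝ) : Mink n × Mink n →L[ℝ] Mink n × Mink n :=
  ContinuousLinearMap.prod
    (Real.cosh t • ContinuousLinearMap.fst ℝ _ _ + Real.sinh t • ContinuousLinearMap.snd ℝ _ _)
    (Real.sinh t • ContinuousLinearMap.fst ℝ _ _ + Real.cosh t • ContinuousLinearMap.snd ℝ _ _)

theorem flowCLM_apply (t : ℝ) (w : Mink n × Mink n) : flowCLM n t w =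
    (Real.cosh t • w.1 + Real.sinh t • w.2, Real.sinh t • w.1 + Real.cosh t • w.2) := rfl

theorem contMDiff_flow (t : ℝ) : ContMDiff (model n) (model n) ∞ (flow (n := n) t) :=
  contMDiff_of_incl ((flowCLM n t).contMDiff.comp contMDiff_incl)

/-- The differential of the geodesic flow. -/
def dflow (t : ℝ) (z : UT n) : z.T →L[ℝ] (flow t z).T := mfderiv (model n) (model n) (flow t) z

/-- The flow is linear in ambient coordinates, so its differential is given by the same linear map.
-/
theorem dIncl_dflow (t : ℝ) (z : UT n) (X : z.T) :
    (flow t z).dIncl (dflow t z X) = flowCLM n t (z.dIncl X) := by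
  rw [← mvfderiv_comp_incl z (flowCLM n t).hasFDerivAt X]
  have h := HasMFDerivAt.comp z (mdifferentiable_incl (flow t z)).hasMFDerivAt
    ((contMDiff_flow t).mdifferentiable (by simp) z).hasMFDerivAt
  exact (congrArg (fun f => f X) h.mfderiv).symm

/-- Infinitesimal form of the invariance of `ω`. Tangency kills the mixed terms and turns `⟨x, v̇⟩`
into `-⟨v, ẋ⟩`, leaving the factor `cosh² t - sinh² t = 1`. -/
theorem connection_dflow (t : ℝ) (z : UT n) (X : z.T) :
    mink n (flow t z).vec ((flow t z).dIncl (dflow t z X)).1 = mink n z.vec (z.dIncl X).1 := by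
  obtain ⟨h1, h2, h3⟩ := z.dIncl_mem X
  have hv : (flow t z).vec = Real.sinh t • z.pt + Real.cosh t • z.vec := rfl
  have h4 : mink n z.pt (z.dIncl X).2 = -mink n z.vec (z.dIncl X).1 := by linarith
  rw [dIncl_dflow, flowCLM_apply, hv]
  simp only [map_add, map_smul, add_apply, smul_apply, smul_eq_mul, h1, h2, h4]
  linear_combination mink n z.vec (z.dIncl X).1 * Real.cosh_sq t

theorem formPullback_flow_connection (t : ℝ) :
    formPullback (model n) (model n) (flow t) (connection n) = connection n := by
  funext z
  ext X
  rw [connection_apply, paraSasaki_generator, mink_comm, ← connection_dflow t, mink_comm,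
    ← paraSasaki_generator]
  rfl

/-! ### Fibres of the projection and orbits of the flow -/

theorem p_eq_iff {z z' : UT n} : z.p = z'.p ↔
    (z.pt - z.vec).2⁻¹ • (z.pt - z.vec) = (z'.pt - z'.vec).2⁻¹ • (z'.pt - z'.vec) ∧
    (z.pt + z.vec).2⁻¹ • (z.pt + z.vec) = (z'.pt + z'.vec).2⁻¹ • (z'.pt + z'.vec) := by
  have hs : (z.pt - z.vec).2 ≠ 0 := z.sub_pos.ne'
  have ha : (z.pt + z.vec).2 ≠ 0 := z.add_pos.ne'
  have hs' : (z'.pt - z'.vec).2 ≠ 0 := z'.sub_pos.ne'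
  have ha' : (z'.pt + z'.vec).2 ≠ 0 := z'.add_pos.ne'
  have key : ∀ {y y' : Mink n}, y.2 ≠ 0 → y'.2 ≠ 0 →
      (y.2⁻¹ • y.1 = y'.2⁻¹ • y'.1 ↔ y.2⁻¹ • y = y'.2⁻¹ • y') := by
    intro y y' h h'
    simp only [Prod.ext_iff, Prod.smul_fst, Prod.smul_snd, smul_eq_mul, inv_mul_cancel₀ h,
      inv_mul_cancel₀ h', and_true]
  rw [← key hs hs', ← key ha ha']
  simp only [p, endpoint, Subtype.mk.injEq, Prod.mk.injEq]

/-- The flow multiplies the null vectors `x - v` and `x + v` by `e^{-t}` and `e^t`, and an endpoint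
depends only on the ray. -/
theorem p_flow (t : ℝ) (z : UT n) : (flow t z).p = z.p := by
  have key : ∀ {y : Mink n} {c : ℝ}, c ≠ 0 → (c • y).2⁻¹ • (c • y) = y.2⁻¹ • y := by
    intro y c hc
    rw [Prod.smul_snd, smul_eq_mul, mul_inv, smul_smul, mul_right_comm, inv_mul_cancel₀ hc,
      one_mul]
  have hs : (flow t z).pt - (flow t z).vec = Real.exp (-t) • (z.pt - z.vec) := by
    rw [← Real.cosh_sub_sinh]
    change (Real.cosh t • z.pt + Real.sinh t • z.vec) -
      (Real.sinh t • z.pt + Real.cosh t • z.vec) = _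
    module
  have ha : (flow t z).pt + (flow t z).vec = Real.exp t • (z.pt + z.vec) := by
    rw [← Real.cosh_add_sinh]
    change (Real.cosh t • z.pt + Real.sinh t • z.vec) +
      (Real.sinh t • z.pt + Real.cosh t • z.vec) = _
    module
  rw [p_eq_iff, hs, ha]
  exact ⟨key (Real.exp_ne_zero _), key (Real.exp_ne_zero _)⟩

theorem mink_sub_add (z : UT n) : mink n (z.pt - z.vec) (z.pt + z.vec) = -2 := by
  simp [mink_pt_pt, mink_pt_vec, mink_vec_pt, mink_vec_vec]
  norm_num

/-- Equal endpoints make `x' - v'` and `x' + v'` multiples `c`, `d` of `x - v` and `x + v`. Both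
pairs have product `-2`, which forces `cd = 1`, so `d = e^t` and `c = e^{-t}` with `t = log d`. -/
theorem exists_flow_of_p_eq {z z' : UT n} (h : z.p = z'.p) : ∃ t, flow t z = z' := by
  obtain ⟨h1, h2⟩ := p_eq_iff.1 h
  have hs : 0 < (z.pt - z.vec).2 := z.sub_pos
  have ha : 0 < (z.pt + z.vec).2 := z.add_pos
  have hs' : 0 < (z'.pt - z'.vec).2 := z'.sub_pos
  have ha' : 0 < (z'.pt + z'.vec).2 := z'.add_pos
  have key : ∀ {y y' : Mink n}, 0 < y'.2 → y.2⁻¹ • y = y'.2⁻¹ • y' →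
      y' = (y'.2 * y.2⁻¹) • y := by
    intro y y' hy' hyy
    rw [mul_smul, hyy, smul_smul, mul_inv_cancel₀ hy'.ne', one_smul]
  have e1 := key hs' h1
  have e2 := key ha' h2
  set c := (z'.pt - z'.vec).2 * (z.pt - z.vec).2⁻¹ with hc
  set d := (z'.pt + z'.vec).2 * (z.pt + z.vec).2⁻¹ with hd
  have hd0 : 0 < d := by positivity
  have hcd : c * d = 1 := by
    have h3 := z'.mink_sub_add
    rw [e1, e2, map_smul, map_smul, smul_apply, mink_sub_add] at h3
    simp only [smul_eq_mul] at h3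
    linarith
  refine ⟨Real.log d, ?_⟩
  have hexp : Real.exp (Real.log d) = d := Real.exp_log hd0
  have hexp' : Real.exp (-Real.log d) = c := by
    rw [Real.exp_neg, hexp, eq_inv_of_mul_eq_one_left hcd]
  have hpt : z'.pt = (2⁻¹ : ℝ) • ((z'.pt - z'.vec) + (z'.pt + z'.vec)) := by module
  have hvec : z'.vec = (2⁻¹ : ℝ) • ((z'.pt + z'.vec) - (z'.pt - z'.vec)) := by module
  have hch : Real.cosh (Real.log d) = (d + c) / 2 := by rw [Real.cosh_eq, hexp, hexp']
  have hsh : Real.sinh (Real.log d) = (d - c) / 2 := by rw [Real.sinh_eq, hexp, hexp']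
  refine Subtype.ext (Prod.ext ?_ ?_)
  · change Real.cosh (Real.log d) • z.pt + Real.sinh (Real.log d) • z.vec = z'.pt
    rw [hpt, e1, e2, hch, hsh]
    module
  · change Real.sinh (Real.log d) • z.pt + Real.cosh (Real.log d) • z.vec = z'.vec
    rw [hvec, e1, e2, hch, hsh]
    module

theorem p_eq_p_iff (z z' : UT n) : z.p = z'.p ↔ ∃ t : ℝ, flow t z = z' :=
  ⟨exists_flow_of_p_eq, by rintro ⟨t, rfl⟩; exact (p_flow t z).symm⟩

end UT

/-! ### Descent of the tensors to the space of geodesics -/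

namespace UT
variable {n : ℕ}

theorem flow_zero (z : UT n) : flow 0 z = z :=
  Subtype.ext (Prod.ext (by simp [flow, pt]) (by simp [flow, vec]))

theorem contMDiff_flow_curve (z : UT n) :
    ContMDiff 𝓘(ℝ, ℝ) (model n) ∞ (fun t => flow t z) := by
  refine contMDiff_of_incl (ContDiff.contMDiff ?_)
  have h : ContDiff ℝ ∞ (fun t : ℝ => (Real.cosh t • z.pt + Real.sinh t • z.vec,
      Real.sinh t • z.pt + Real.cosh t • z.vec)) := by fun_prop
  exact h

/-- Injectivity of `dIncl` identifies `Y` with the velocity of a curve inside a fibre, where `p` is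
constant. -/
theorem dp_eq_zero_of_curve {γ : ℝ → UT n} (hγ : ContMDiff 𝓘(ℝ, ℝ) (model n) ∞ γ) {t : ℝ}
    {Y : (γ t).T} (hY : HasDerivAt (fun s => (γ s).incl) ((γ t).dIncl Y) t) {ℓ : Geod n}
    (hp : ∀ s, (γ s).p = ℓ) : (γ t).dp Y = 0 := by
  have hd := (hγ.mdifferentiable (by simp) t).hasMFDerivAt
  have h1 := HasMFDerivAt.comp t (mdifferentiable_incl (γ t)).hasMFDerivAt hd
  have h2 := HasMFDerivAt.comp t (contMDiff_p.mdifferentiable (by simp) (γ t)).hasMFDerivAt hd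
  have e1 := congrArg (fun f => f (1 : ℝ))
    (h1.mfderiv.symm.trans hY.hasFDerivAt.hasMFDerivAt.mfderiv)
  have e1' : (γ t).dIncl (mfderiv 𝓘(ℝ, ℝ) (model n) γ t (1 : ℝ)) = (γ t).dIncl Y :=
    e1.trans (one_smul ℝ _)
  have hc : p ∘ γ = fun _ => ℓ := funext hp
  rw [hc] at h2
  have e2 := congrArg (fun f => f (1 : ℝ)) (h2.mfderiv.symm.trans mfderiv_const)
  rw [← (γ t).dIncl_injective e1']
  exact e2

theorem dp_generator (z : UT n) : z.dp z.generator = 0 := by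
  -- The flow line at time `0` sits at `flow 0 w`; renaming the base point avoids transporting
  -- tangent vectors along `flow_zero`.
  obtain ⟨w, rfl⟩ : ∃ w, z = flow 0 w := ⟨z, (flow_zero z).symm⟩
  refine dp_eq_zero_of_curve (γ := fun t => flow t w) (contMDiff_flow_curve w) ?_
    fun s => p_flow s w
  have h := hasDerivAt_flow w
  rw [dIncl_generator] at h
  change HasDerivAt _ ((flow 0 w).dIncl (flow 0 w).generator) 0
  rw [dIncl_generator, flow_zero]
  exact h

/-- Since `ω(χ) = 1`, subtracting `ω(Y) χ` projects onto `χ^⊥`. -/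
theorem exists_chiPerp_add_smul_generator (z : UT n) (Y : z.T) :
    ∃ (X : z.chiPerp) (c : ℝ), Y = X + c • z.generator := by
  refine ⟨⟨Y - z.paraSasaki Y z.generator • z.generator, ?_⟩, z.paraSasaki Y z.generator,
    (sub_add_cancel _ _).symm⟩
  rw [chiPerp, LinearMap.mem_ker, LinearMap.flip_apply, map_sub, map_smul]
  simp [paraSasaki_generator_self]

theorem dflow_mem_chiPerp (t : ℝ) (z : UT n) (X : z.chiPerp) :
    dflow t z X ∈ (flow t z).chiPerp := by
  rw [mem_chiPerp, connection_dflow, ← mem_chiPerp]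
  exact X.2

/-- The chain rule for `p ∘ φ_t = p`. The two sides live in tangent spaces at `(flow t z).p` and
`z.p`, so they are compared in the common model space. -/
theorem dp_dflow (t : ℝ) (z : UT n) (X : z.T) :
    @Eq (EuclideanSpace ℝ (Fin n) × EuclideanSpace ℝ (Fin n))
      ((flow t z).dp (dflow t z X)) (z.dp X) := by
  have h := HasMFDerivAt.comp z (contMDiff_p.mdifferentiable (by simp) (flow t z)).hasMFDerivAt
    ((contMDiff_flow t).mdifferentiable (by simp) z).hasMFDerivAt
  have hc : p ∘ flow t = p (n := n) := funext (p_flow t)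
  rw [hc] at h
  exact (congrArg (fun f => f X) h.mfderiv).symm

theorem horizontalEquivAt_apply (z : UT n) {ℓ : Geod n} (h : z.p = ℓ) (X : z.chiPerp) :
    @Eq (EuclideanSpace ℝ (Fin n) × EuclideanSpace ℝ (Fin n))
      (z.horizontalEquivAt h X) (z.dp X) := by
  subst h
  rfl

/-- The image of `X` under the differential of the flow is orthogonal to `χ` and has the same
projection as `X`, so it is the lift at `w`. -/
theorem dIncl_horizontalEquivAt_symm {z w : UT n} {t : ℝ} (hw : flow t z = w) (h : w.p = z.p)
    (X : z.chiPerp) :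
    w.dIncl ((w.horizontalEquivAt h).symm (z.dp X)) = flowCLM n t (z.dIncl X) := by
  subst hw
  have e : ((flow t z).horizontalEquivAt h).symm (z.dp X) =
      ⟨dflow t z X, dflow_mem_chiPerp t z X⟩ := by
    rw [LinearEquiv.symm_apply_eq]
    exact ((horizontalEquivAt_apply _ h _).trans (dp_dflow t z X)).symm
  rw [e]
  exact dIncl_dflow t z X

/-- The arbitrary lift in the definitions of `𝔾` and `𝕁` lies on the orbit of `z`. A single time `t`
therefore compares the two lifts of all tangent vectors. -/
theorem exists_dIncl_tangentLift (z : UT n) : ∃ t : ℝ, ∀ X : z.chiPerp,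
    (Geod.lift z.p).dIncl (Geod.tangentLift z.p (z.dp X)) = flowCLM n t (z.dIncl X) := by
  obtain ⟨t, ht⟩ := exists_flow_of_p_eq (Geod.p_lift z.p).symm
  exact ⟨t, dIncl_horizontalEquivAt_symm ht (Geod.p_lift z.p)⟩

theorem paraSasaki_chiPerp (z : UT n) (X Y : z.chiPerp) : z.paraSasaki X Y =
    mink n (z.dIncl X).1 (z.dIncl Y).1 - mink n (z.dIncl X).2 (z.dIncl Y).2 := by
  rw [paraSasaki_apply, paraSasakiModel_apply, connector_apply, connector_apply,
    z.mink_pt_of_mem_chiPerp X.2, z.mink_pt_of_mem_chiPerp Y.2]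
  simp

/-- On `χ^⊥` the metric is `⟨ẋ₁, ẋ₂⟩ - ⟨v̇₁, v̇₂⟩`; `flowCLM` scales it by `cosh² t - sinh² t = 1`.
-/
theorem metric_dp (z : UT n) (X Y : z.chiPerp) :
    Geod.metric z.p (z.dp X) (z.dp Y) = z.paraSasaki X Y := by
  obtain ⟨t, ht⟩ := z.exists_dIncl_tangentLift
  change (Geod.lift z.p).paraSasaki (Geod.tangentLift z.p (z.dp X))
    (Geod.tangentLift z.p (z.dp Y)) = _
  rw [paraSasaki_chiPerp, paraSasaki_chiPerp, ht, ht, flowCLM_apply, flowCLM_apply]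
  simp only [map_add, map_smul, add_apply, smul_apply, smul_eq_mul]
  linear_combination (mink n (z.dIncl X).1 (z.dIncl Y).1 - mink n (z.dIncl X).2 (z.dIncl Y).2) *
    Real.cosh_sq t

/-- The coefficient matrix of `flowCLM` is symmetric with equal diagonal entries, so it commutes
with the swap of the two components. -/
theorem paraComplex_dp (z : UT n) (X : z.chiPerp) :
    Geod.paraComplex z.p (z.dp X) = z.dp (z.J X) := by
  obtain ⟨t, ht⟩ := z.exists_dIncl_tangentLift
  change (Geod.tangentLift z.p).symm ((Geod.lift z.p).J (Geod.tangentLift z.p (z.dp X))) = _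
  rw [LinearEquiv.symm_apply_eq]
  refine Subtype.ext ((Geod.lift z.p).dIncl_injective ?_)
  rw [dIncl_J, ht, ht, dIncl_J, flowCLM_apply, flowCLM_apply]
  exact Prod.ext (add_comm _ _) (add_comm _ _)

theorem symplecticForm_dp (z : UT n) (X Y : z.chiPerp) :
    Geod.symplecticForm n z.p ![z.dp X, z.dp Y] = ambientForm n ![z.dIncl X, z.dIncl Y] := by
  change Geod.metric z.p (z.dp X) (Geod.paraComplex z.p (z.dp Y)) = _
  rw [paraComplex_dp, metric_dp, paraSasaki_chiPerp, dIncl_J]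
  rfl

/-- Pairing `(ẋ, v̇)` with `χ = (v, x)` gives `⟨ẋ, x⟩ - ⟨v̇, v⟩`, and both terms vanish by tangency.
-/
theorem ambientForm_add_generator (z : UT n) (X Y : z.T) (c d : ℝ) :
    ambientForm n ![z.dIncl (X + c • z.generator), z.dIncl (Y + d • z.generator)] =
      ambientForm n ![z.dIncl X, z.dIncl Y] := by
  obtain ⟨h1, h2, h3⟩ := z.dIncl_mem X
  obtain ⟨k1, k2, k3⟩ := z.dIncl_mem Y
  simp only [ambientForm_apply, map_add, map_smul, dIncl_generator, Matrix.cons_val_zero,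
    Matrix.cons_val_one, Prod.fst_add, Prod.snd_add, Prod.smul_fst, Prod.smul_snd, add_apply,
    smul_apply, smul_eq_mul, mink_pt_vec, mink_vec_pt, mink_comm (z.dIncl X).1 z.pt,
    mink_comm (z.dIncl X).2 z.vec, h1, h2, k1, k2]
  ring

/-- Both sides ignore the `χ` components of their arguments and agree on `χ^⊥`. This links the
abstractly defined `Ω` to a constant form. -/
theorem formPullback_p_symplecticForm :
    formPullback (model n) (Geod.model n) p (Geod.symplecticForm n) =
      formPullback (model n) 𝓘(ℝ, Mink n × Mink n) incl (fun _ => ambientForm n) := by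
  funext z
  ext a
  obtain ⟨X, c, hX⟩ := z.exists_chiPerp_add_smul_generator (a 0)
  obtain ⟨Y, d, hY⟩ := z.exists_chiPerp_add_smul_generator (a 1)
  have hdp : ∀ (W : z.chiPerp) (c : ℝ), z.dp (W + c • z.generator) = z.dp W := fun W c => by
    rw [map_add, map_smul, dp_generator, smul_zero, add_zero]
  change Geod.symplecticForm n z.p ![z.dp (a 0), z.dp (a 1)] =
    ambientForm n ![z.dIncl (a 0), z.dIncl (a 1)]
  rw [hX, hY, hdp, hdp, symplecticForm_dp, ambientForm_add_generator]

theorem extD_connection_eq (z : UT n) : extD (model n) (connection n) z =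
    -formPullback (model n) (Geod.model n) p (Geod.symplecticForm n) z := by
  rw [extD_connection, formPullback_p_symplecticForm]
  rfl

/-! ### Non-degeneracy -/

/-- Positivity on the orthogonal complement of a timelike vector. With `q = ⟨u, u⟩`, and `x₂`, `u₂`
the time coordinates, Cauchy–Schwarz for the space parts reads `u₂² ≤ q (x₂² - 1)`. -/
theorem mink_self_of_mink_pt_eq_zero (z : UT n) {u : Mink n} (h : mink n z.pt u = 0) :
    0 ≤ mink n u u ∧ (mink n u u = 0 → u = 0) := by
  have h1 := real_inner_mul_inner_self_le z.pt.1 u.1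
  rw [mink_apply] at h
  rw [inner_pt_pt, show inner ℝ z.pt.1 u.1 = z.pt.2 * u.2 by linarith] at h1
  have h2 : inner ℝ u.1 u.1 = mink n u u + u.2 * u.2 := by rw [mink_apply]; ring
  have h3 : 0 ≤ inner ℝ u.1 u.1 := real_inner_self_nonneg
  have hp := z.pt_pos
  rw [h2] at h1 h3
  have h4 : u.2 * u.2 ≤ mink n u u * (z.pt.2 * z.pt.2 - 1) := by nlinarith
  have h5 : 0 ≤ mink n u u := by
    -- If `q < 0`, then `q + u₂² ≤ q x₂² < 0`, although `q + u₂²` is the squared norm of the space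
    -- part.
    by_contra! hneg
    nlinarith [mul_pos hp hp, mul_self_nonneg u.2]
  refine ⟨h5, fun h0 => ?_⟩
  rw [h0, zero_mul] at h4
  have h6 : u.2 = 0 := mul_self_eq_zero.1 (le_antisymm h4 (mul_self_nonneg _))
  rw [h0, h6, mul_zero, add_zero] at h2
  exact Prod.ext (inner_self_eq_zero.1 h2) h6

/-- The test vector `(-v̇, ẋ)` again lies in `χ^⊥` and turns the form into `⟨ẋ, ẋ⟩ + ⟨v̇, v̇⟩`, a
sum of non-negative terms since `ẋ` and `v̇` are orthogonal to `x`. -/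
theorem eq_zero_of_ambientForm_eq_zero (z : UT n) (X : z.chiPerp)
    (h : ∀ Y : z.chiPerp, ambientForm n ![z.dIncl X, z.dIncl Y] = 0) : X = 0 := by
  obtain ⟨h1, h2, -⟩ := z.dIncl_mem X
  have h3 := (z.mem_chiPerp X).1 X.2
  have h4 := z.mink_pt_of_mem_chiPerp X.2
  have hm : (-(z.dIncl X).2, (z.dIncl X).1) ∈ z.tangentModel := by
    refine ⟨?_, h3, ?_⟩ <;> simp [h1, h2, h4]
  have hY := h ⟨z.tangentEquiv.symm ⟨_, hm⟩, by
    rw [mem_chiPerp, dIncl_tangentEquiv_symm]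
    simp [h2]⟩
  rw [dIncl_tangentEquiv_symm, ambientForm_apply] at hY
  simp only [Matrix.cons_val_zero, Matrix.cons_val_one, map_neg] at hY
  obtain ⟨p1, q1⟩ := z.mink_self_of_mink_pt_eq_zero h1
  obtain ⟨p2, q2⟩ := z.mink_self_of_mink_pt_eq_zero h4
  refine Subtype.ext (z.dIncl_injective ?_)
  rw [ZeroMemClass.coe_zero, map_zero]
  exact Prod.ext (q1 (by linarith)) (q2 (by linarith))

end UT

/-! ### The symplectic form through a global section -/

namespace Geod
variable {n : ℕ}

theorem symplecticForm_nondegenerate (ℓ : Geod n) (A : T ℓ)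
    (h : ∀ B : T ℓ, symplecticForm n ℓ ![A, B] = 0) : A = 0 := by
  obtain ⟨z, rfl⟩ := UT.p_surjective ℓ
  obtain ⟨X, rfl⟩ := z.horizontalEquiv.surjective A
  rw [z.eq_zero_of_ambientForm_eq_zero X fun Y => ?_, map_zero]
  rw [← UT.symplecticForm_dp]
  exact h (z.dp Y)

/-- The unit tangent vector of the geodesic with endpoints `q.1`, `q.2` at its point closest to
the origin of the hyperboloid, as a map on the ambient space. -/
def nearest (q : Euc n × Euc n) : Mink n × Mink n :=
  (√(2 * (1 - inner ℝ q.1 q.2)))⁻¹ • ((q.1 + q.2, 2), (q.2 - q.1, 0))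

theorem inner_lt_one (ℓ : Geod n) : inner ℝ (ℓ.1.1 : Euc n) (ℓ.1.2 : Euc n) < (1 : ℝ) := by
  have ha := norm_eq_of_mem_sphere ℓ.1.1
  have hb := norm_eq_of_mem_sphere ℓ.1.2
  refine lt_of_le_of_ne ?_ fun h => ℓ.2 (Subtype.ext ((inner_eq_one_iff_of_norm_eq_one ha hb).1 h))
  simpa [ha, hb] using real_inner_le_norm (ℓ.1.1 : Euc n) ℓ.1.2

/-- The section of `p` given by the point closest to the origin of the hyperboloid. -/
def nearestSection (ℓ : Geod n) : UT n :=
  ⟨nearest (ℓ.1.1, ℓ.1.2), by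
    have ha : inner ℝ (ℓ.1.1 : Euc n) (ℓ.1.1 : Euc n) = (1 : ℝ) := by
      rw [real_inner_self_eq_norm_sq, norm_eq_of_mem_sphere]; norm_num
    have hb : inner ℝ (ℓ.1.2 : Euc n) (ℓ.1.2 : Euc n) = (1 : ℝ) := by
      rw [real_inner_self_eq_norm_sq, norm_eq_of_mem_sphere]; norm_num
    have hpos : 0 < 2 * (1 - inner ℝ (ℓ.1.1 : Euc n) (ℓ.1.2 : Euc n)) := by
      have := inner_lt_one ℓ
      linarith
    -- For endpoints `a`, `b`, the vectors `(a + b, 2)` and `(b - a, 0)` have Minkowski squares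
    -- `-2(1 - ⟨a, b⟩)` and `2(1 - ⟨a, b⟩)`, so one factor normalises both.
    have hs2 : (√(2 * (1 - inner ℝ (ℓ.1.1 : Euc n) (ℓ.1.2 : Euc n))))⁻¹ *
        (√(2 * (1 - inner ℝ (ℓ.1.1 : Euc n) (ℓ.1.2 : Euc n))))⁻¹ *
        (2 * (1 - inner ℝ (ℓ.1.1 : Euc n) (ℓ.1.2 : Euc n))) = 1 := by
      rw [← mul_inv, Real.mul_self_sqrt hpos.le, inv_mul_cancel₀ hpos.ne']
    have hs0 : 0 < (√(2 * (1 - inner ℝ (ℓ.1.1 : Euc n) (ℓ.1.2 : Euc n))))⁻¹ := by positivity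
    simp only [nearest, mink_apply, Prod.smul_fst, Prod.smul_snd, inner_add_left, inner_add_right,
      inner_sub_left, inner_sub_right, inner_smul_left, inner_smul_right, conj_trivial, ha, hb,
      real_inner_comm (ℓ.1.1 : Euc n) (ℓ.1.2 : Euc n), smul_eq_mul]
    exact ⟨⟨by linarith, by positivity⟩, by ring, by linarith⟩⟩

/-- With `s` the normalising factor, `x - v = 2s (a, 1)` and `x + v = 2s (b, 1)`. -/
theorem p_nearestSection (ℓ : Geod n) : (nearestSection ℓ).p = ℓ := by
  have hpos : 0 < 2 * (1 - inner ℝ (ℓ.1.1 : Euc n) (ℓ.1.2 : Euc n)) := by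
    have := inner_lt_one ℓ
    linarith
  have hs0 : (√(2 * (1 - inner ℝ (ℓ.1.1 : Euc n) (ℓ.1.2 : Euc n))))⁻¹ ≠ 0 := by positivity
  set s := (√(2 * (1 - inner ℝ (ℓ.1.1 : Euc n) (ℓ.1.2 : Euc n))))⁻¹ with hs
  have hpt : (nearestSection ℓ).pt = (s • ((ℓ.1.1 : Euc n) + ℓ.1.2), s * 2) := rfl
  have hvec : (nearestSection ℓ).vec = (s • ((ℓ.1.2 : Euc n) - ℓ.1.1), s * 0) := rfl
  have hc : (s * 2)⁻¹ * (s * 2) = 1 := inv_mul_cancel₀ (by positivity)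
  refine Subtype.ext (Prod.ext (Subtype.ext ?_) (Subtype.ext ?_))
  · change ((nearestSection ℓ).pt - (nearestSection ℓ).vec).2⁻¹ •
      ((nearestSection ℓ).pt - (nearestSection ℓ).vec).1 = (ℓ.1.1 : Euc n)
    rw [hpt, hvec]
    simp only [Prod.mk_sub_mk, mul_zero, sub_zero]
    rw [show s • ((ℓ.1.1 : Euc n) + ℓ.1.2) - s • ((ℓ.1.2 : Euc n) - ℓ.1.1) =
      (s * 2) • (ℓ.1.1 : Euc n) by module, smul_smul, hc, one_smul]
  · change ((nearestSection ℓ).pt + (nearestSection ℓ).vec).2⁻¹ •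
      ((nearestSection ℓ).pt + (nearestSection ℓ).vec).1 = (ℓ.1.2 : Euc n)
    rw [hpt, hvec]
    simp only [Prod.mk_add_mk, mul_zero, add_zero]
    rw [show s • ((ℓ.1.1 : Euc n) + ℓ.1.2) + s • ((ℓ.1.2 : Euc n) - ℓ.1.1) =
      (s * 2) • (ℓ.1.2 : Euc n) by module, smul_smul, hc, one_smul]

theorem contMDiff_nearestSection :
    ContMDiff (model n) (UT.model n) ∞ (nearestSection (n := n)) := by
  have hF : Fact (Module.finrank ℝ (Euc n) = n + 1) := ⟨finrank_euclideanSpace_fin⟩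
  refine UT.contMDiff_of_incl fun ℓ => ?_
  have hcoe : ContMDiff (𝓡 n) 𝓘(ℝ, Euc n) ∞ ((↑) : sphere (0 : Euc n) 1 → Euc n) :=
    contMDiff_coe_sphere
  have hval : ContMDiff (model n) (model n) ∞ (Subtype.val : Geod n → _) := contMDiff_subtype_val
  have hq : ContMDiff (model n) 𝓘(ℝ, Euc n × Euc n) ∞
      (fun ℓ : Geod n => ((ℓ.1.1 : Euc n), (ℓ.1.2 : Euc n))) :=
    (hcoe.comp (contMDiff_fst.comp hval)).prodMk_space (hcoe.comp (contMDiff_snd.comp hval))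
  -- Distinctness of the endpoints keeps the square root and its inverse in their domain of
  -- smoothness.
  have hpos : 0 < 2 * (1 - inner ℝ (ℓ.1.1 : Euc n) (ℓ.1.2 : Euc n)) := by
    have := inner_lt_one ℓ
    linarith
  have hi : ContDiff ℝ ∞ fun q : Euc n × Euc n => 2 * (1 - inner ℝ q.1 q.2) :=
    contDiff_const.mul (contDiff_const.sub (contDiff_fst.inner ℝ contDiff_snd))
  have h1 : ContDiffAt ℝ ∞ (fun q : Euc n × Euc n => (√(2 * (1 - inner ℝ q.1 q.2)))⁻¹)
      ((ℓ.1.1 : Euc n), (ℓ.1.2 : Euc n)) :=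
    ContDiffAt.inv (ContDiffAt.sqrt hi.contDiffAt hpos.ne') (Real.sqrt_pos.2 hpos).ne'
  have h2 : ContDiff ℝ ∞
      (fun q : Euc n × Euc n => (((q.1 + q.2, 2), (q.2 - q.1, 0)) : Mink n × Mink n)) :=
    ((contDiff_fst.add contDiff_snd).prodMk contDiff_const).prodMk
      ((contDiff_snd.sub contDiff_fst).prodMk contDiff_const)
  have hn : ContDiffAt ℝ ∞ (nearest (n := n)) ((ℓ.1.1 : Euc n), (ℓ.1.2 : Euc n)) :=
    h1.smul h2.contDiffAt
  have h := ContMDiffAt.comp (g := nearest)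
    (f := fun ℓ : Geod n => ((ℓ.1.1 : Euc n), (ℓ.1.2 : Euc n))) ℓ hn.contMDiffAt (hq ℓ)
  exact h

/-- For a section `σ` of `p`, `Ω = σ^* p^* Ω`. The pointwise definition of `Ω` uses an arbitrary
choice of lifts; this formula replaces it by a smooth one, from which smoothness and closedness
follow. -/
theorem symplecticForm_eq_formPullback : symplecticForm n =
    formPullback (model n) 𝓘(ℝ, Mink n × Mink n) (UT.incl ∘ nearestSection)
      (fun _ => UT.ambientForm n) := by
  have hs : MDifferentiable (model n) (UT.model n) (nearestSection (n := n)) :=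
    contMDiff_nearestSection.mdifferentiable (by simp)
  refine Eq.trans ?_ (formPullback_comp UT.mdifferentiable_incl hs _).symm
  rw [← UT.formPullback_p_symplecticForm,
    ← formPullback_comp (UT.contMDiff_p.mdifferentiable (by simp)) hs,
    show UT.p ∘ nearestSection = id from funext p_nearestSection, formPullback_id]

theorem contMDiff_incl_comp_nearestSection : ContMDiff (model n) 𝓘(ℝ, Mink n × Mink n) ∞
    (UT.incl ∘ nearestSection (n := n)) :=
  UT.contMDiff_incl.comp contMDiff_nearestSection

theorem smoothForm_symplecticForm : SmoothForm (model n) (symplecticForm n) := by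
  rw [symplecticForm_eq_formPullback]
  exact smoothForm_formPullback contMDiff_incl_comp_nearestSection contDiff_const

theorem extD_symplecticForm (ℓ : Geod n) : extD (model n) (symplecticForm n) ℓ = 0 := by
  rw [symplecticForm_eq_formPullback,
    extD_formPullback contMDiff_incl_comp_nearestSection contDiff_const]
  have h : extDeriv (fun _ : Mink n × Mink n => UT.ambientForm n) = fun _ => 0 := by
    funext w
    ext a
    rw [extDeriv_apply (differentiableAt_const _)]
    simp
  rw [h]
  rfl

end Geod

end GeodesicSpace

end

theorem mainTheorem10 (n : ℕ) :
    -- the fibres of `p` are the orbits of the geodesic flow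
    (∀ z z' : GeodesicSpace.UT n, z.p = z'.p ↔ ∃ t : ℝ, GeodesicSpace.UT.flow t z = z') ∧
    -- `ω` is a connection form: smooth, invariant under the flow, and `ω(χ) = 1`
    GeodesicSpace.SmoothForm (GeodesicSpace.UT.model n) (GeodesicSpace.UT.connection n) ∧
    (∀ t : ℝ, GeodesicSpace.formPullback (GeodesicSpace.UT.model n) (GeodesicSpace.UT.model n)
      (GeodesicSpace.UT.flow t) (GeodesicSpace.UT.connection n) =
        GeodesicSpace.UT.connection n) ∧
    (∀ z : GeodesicSpace.UT n, GeodesicSpace.UT.connection n z (fun _ => z.generator) = 1) ∧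
    -- the tensors on the space of geodesics do not depend on the choice of the lift
    (∀ (z : GeodesicSpace.UT n) (X Y : z.chiPerp),
      GeodesicSpace.Geod.metric z.p (z.dp X) (z.dp Y) = z.paraSasaki X Y ∧
      GeodesicSpace.Geod.paraComplex z.p (z.dp X) = z.dp (z.J X)) ∧
    -- the curvature identity `dω = - p^* Ω`
    (∀ z : GeodesicSpace.UT n,
      GeodesicSpace.extD (GeodesicSpace.UT.model n) (GeodesicSpace.UT.connection n) z =
        -GeodesicSpace.formPullback (GeodesicSpace.UT.model n) (GeodesicSpace.Geod.model n)
          GeodesicSpace.UT.p (GeodesicSpace.Geod.symplecticForm n) z) ∧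
    -- `Ω` is smooth, non-degenerate and closed
    GeodesicSpace.SmoothForm (GeodesicSpace.Geod.model n)
      (GeodesicSpace.Geod.symplecticForm n) ∧
    (∀ (ℓ : GeodesicSpace.Geod n) (A : GeodesicSpace.Geod.T ℓ),
      (∀ B : GeodesicSpace.Geod.T ℓ,
        GeodesicSpace.Geod.symplecticForm n ℓ ![A, B] = 0) → A = 0) ∧
    (∀ ℓ : GeodesicSpace.Geod n,
      GeodesicSpace.extD (GeodesicSpace.Geod.model n)
        (GeodesicSpace.Geod.symplecticForm n) ℓ = 0) := by
  open GeodesicSpace in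
  exact ⟨UT.p_eq_p_iff, UT.smoothForm_connection, UT.formPullback_flow_connection,
    UT.connection_generator, fun z X Y => ⟨z.metric_dp X Y, z.paraComplex_dp X⟩,
    UT.extD_connection_eq, Geod.smoothForm_symplecticForm, Geod.symplecticForm_nondegenerate,
    Geod.extD_symplecticForm⟩
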